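/- **Conventions.** Let $r\ge 0$ be an integer. A graph $\Gamma$ may have loops and multiple edges; if $r$ is odd, every edge is oriented. For a set $X$, let $\Lambda^r[X]$ be the graded commutative ring over $\mathbb Z$ generated by elements $e_x$ ($x\in X$) of degree $r-1$ with the relations $e_xe_y=(-1)^{r-1}e_ye_x$ and $e_x^2=0$ (the exterior algebra on $X$ if $r$ is even, the polynomial ring on $X$ modulo the squares of the variables if $r$ is odd). Put $\Lambda^r(\Gamma)=\Lambda^r[E(\Gamma)]$. A circuit $w$ of length $k\ge 1$ is a closed walk $v_0,w_0,v_1,w_1,\dots,w_{k-1},v_k=v_0$ in which the edge $w_i$ joins $v_i$ and $v_{i+1}$; its Arnold class is $$A(w)=\sum_{i=0}^{k-1}\sigma_i\, e_{w_0}\cdots\widehat{e_{w_i}}\cdots e_{w_{k-1}}\in\Lambda^r(\Gamma),$$ where $\sigma_i=(-1)^i$ if $r$ is even, and, if $r$ is odd, $\sigma_i=1$ or $-1$ according to whether $w_i$ is traversed along or against its orientation (so $A(w)=\pm1$ if $w$ is a single loop). Let $I^r(\Gamma)$ be the ideal generated by the Arnold classes of all circuits of $\Gamma$, and $R^r(\Gamma)=\Lambda^r(\Gamma)/I^r(\Gamma)$,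 a graded commutative ring. Let $\alpha$ be an edge of $\Gamma$ that is not a loop. Let $\Gamma\smallsetminus\alpha$ be obtained from $\Gamma$ by deleting $\alpha$, and $\Gamma/\alpha$ by contracting $\alpha$, that is, by removing $\alpha$ and identifying its two vertices; the edges of both are the edges $\eta\neq\alpha$ of $\Gamma$, and $[\eta]$ denotes $\eta$ as an edge of $\Gamma/\alpha$. Let $\Lambda^r[e_\alpha]$ be the algebra above on the single generator $e_\alpha$, and let $\otimes$ be the tensor product over $\mathbb Z$ of graded commutative rings, with product $(a\otimes b)(a'\otimes b')=(-1)^{\deg b\,\deg a'}aa'\otimes bb'$. There are well-defined ring homomorphisms - $i_\alpha: R^r(\Gamma\smallsetminus\alpha)\to R^r(\Gamma)$, $e_\eta\mapsto e_\eta$; - $q_\alpha: R^r(\Gamma\smallsetminus\alpha)\to R^r(\Gamma/\alpha)$, $e_\eta\mapsto e_{[\eta]}$; - $\iota_\alpha: R^r(\Gamma/\alpha)\to R^r(\Gamma/\alpha)\otimes\Lambda^r[e_\alpha]$, $x\mapsto x\otimes 1$; - $\psi_\alpha: R^r(\Gamma)\to R^r(\Gamma/\alpha)\otimes\Lambda^r[e_\alpha]$,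 $e_\eta\mapsto e_{[\eta]}\otimes 1$ for $\eta\ne\alpha$, and $e_\alpha\mapsto 1\otimes e_\alpha$. **Theorem 1.** The square $$\begin{array}{ccc} R^r(\Gamma\smallsetminus\alpha) & \xrightarrow{\ q_\alpha\ } & R^r(\Gamma/\alpha)\\ {\scriptstyle i_\alpha}\downarrow & & \downarrow{\scriptstyle \iota_\alpha}\\ R^r(\Gamma) & \xrightarrow{\ \psi_\alpha\ } & R^r(\Gamma/\alpha)\otimes\Lambda^r[e_\alpha]\end{array}$$ is a pullback square of rings. The map $i_\alpha$ is injective, and the map $\psi_\alpha$ is surjective. -/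

import Mathlib

open CategoryTheory DirectSum
open scoped TensorProduct

noncomputable section

namespace GraphRing

/-! ### Graphs, deletion, contraction, circuits -/

/-- A graph with vertex set `V` and edge set `E`. Loops and multiple edges are allowed.
Every edge carries an orientation, from `src` to `tgt`; the rings below depend on it
only if the parameter `r` is odd. -/
structure OGraph (V : Type*) (E : Type*) where
  src : E → V
  tgt : E → V

variable {V V' : Type*} {E E' : Type*}

/-- The graph `Γ ∖ α`: same vertices, all the edges but `α`. -/
def OGraph.delete (Γ : OGraph V E) (α : E) : OGraph V {e : E // e ≠ α} where
  src e := Γ.src e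
  tgt e := Γ.tgt e

/-- The vertices of `Γ / α`: the two vertices incident to `α` are identified. -/
def OGraph.ContractVertex (Γ : OGraph V E) (α : E) : Type _ :=
  Quot (fun u v : V => u = Γ.src α ∧ v = Γ.tgt α)

/-- The graph `Γ / α`: the edge `α` is removed and its two vertices are identified. -/
def OGraph.contract (Γ : OGraph V E) (α : E) : OGraph (Γ.ContractVertex α) {e : E // e ≠ α} where
  src e := Quot.mk _ (Γ.src e)
  tgt e := Quot.mk _ (Γ.tgt e)

/-- A step of a walk is an edge together with a direction: `(e, true)` runs along `e` from
`src e` to `tgt e`, and `(e, false)` runs against the orientation of `e`. This is the vertex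
where the step starts. -/
def OGraph.start (Γ : OGraph V E) (d : E × Bool) : V := bif d.2 then Γ.src d.1 else Γ.tgt d.1

/-- The vertex where a step ends. -/
def OGraph.finish (Γ : OGraph V E) (d : E × Bool) : V := bif d.2 then Γ.tgt d.1 else Γ.src d.1

/-- `w` is a walk from `u` to `v`. -/
def OGraph.IsWalk (Γ : OGraph V E) : V → List (E × Bool) → V → Prop
  | u, [], v => u = v
  | u, d :: w, v => Γ.start d = u ∧ Γ.IsWalk (Γ.finish d) w v

/-- A circuit is a closed walk with at least one edge. -/
def OGraph.IsCircuit (Γ : OGraph V E) (w : List (E × Bool)) : Prop :=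
  w ≠ [] ∧ ∃ v, Γ.IsWalk v w v

/-! ### The graded commutative algebra on a set of generators of degree `r - 1` -/

/-- The sign `(-1) ^ (r - 1)`, which is the sign for exchanging two elements of degree `r - 1`. -/
def sgn (r : ℕ) : ℤ := (-1) ^ (r + 1)

/-- The defining relations: graded commutativity of generators of degree `r - 1`,
and the vanishing of the squares of the generators. -/
inductive LambdaRel (r : ℕ) (X : Type*) : FreeAlgebra ℤ X → FreeAlgebra ℤ X → Prop
  | comm (a b : X) : LambdaRel r X (FreeAlgebra.ι ℤ a * FreeAlgebra.ι ℤ b)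
      (sgn r • (FreeAlgebra.ι ℤ b * FreeAlgebra.ι ℤ a))
  | sq (a : X) : LambdaRel r X (FreeAlgebra.ι ℤ a * FreeAlgebra.ι ℤ a) 0

/-- The ring `Λ^r[X]`: the exterior algebra over `ℤ` on `X` if `r` is even, and
the polynomial ring `ℤ[X]` modulo the squares of the variables if `r` is odd. -/
def Lambda (r : ℕ) (X : Type*) : Type _ := RingQuot (LambdaRel r X)

instance (r : ℕ) (X : Type*) : Ring (Lambda r X) := inferInstanceAs (Ring (RingQuot _))

namespace Lambda

variable {r : ℕ} {X : Type*}

/-- The generator `e_x` of `Λ^r[X]`. -/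
def gen (r : ℕ) {X : Type*} (x : X) : Lambda r X :=
  RingQuot.mkRingHom (LambdaRel r X) (FreeAlgebra.ι ℤ x)

theorem gen_comm (a b : X) : gen r a * gen r b = sgn r • (gen r b * gen r a) := by
  have h := RingQuot.mkRingHom_rel (LambdaRel.comm (r := r) a b)
  rw [map_zsmul, map_mul, map_mul] at h
  exact h

theorem gen_sq (a : X) : gen r a * gen r a = 0 := by
  have h := RingQuot.mkRingHom_rel (LambdaRel.sq (r := r) a)
  rw [map_zero, map_mul] at h
  exact h

/-- The ring homomorphism out of `Λ^r[X]` with given values on the generators. -/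
def lift {T : Type*} [Ring T] (f : X → T) (hc : ∀ a b, f a * f b = sgn r • (f b * f a))
    (hs : ∀ a, f a * f a = 0) : Lambda r X →+* T :=
  RingQuot.lift ⟨(FreeAlgebra.lift ℤ f).toRingHom, by
    intro x y h
    cases h with
    | comm a b =>
      have := hc a b
      simpa using this
    | sq a => simpa using hs a⟩

@[simp] theorem lift_gen {T : Type*} [Ring T] (f : X → T)
    (hc : ∀ a b, f a * f b = sgn r • (f b * f a)) (hs : ∀ a, f a * f a = 0) (x : X) :
    lift f hc hs (gen r x) = f x := by
  have := RingQuot.lift_mkRingHom_apply (FreeAlgebra.lift ℤ f).toRingHom (r := LambdaRel r X)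
    (by
      intro x y h
      cases h with
      | comm a b =>
        have := hc a b
        simpa using this
      | sq a => simpa using hs a) (FreeAlgebra.ι ℤ x)
  refine Eq.trans this ?_
  simp

theorem induction {P : Lambda r X → Prop} (hint : ∀ n : ℤ, P n) (hgen : ∀ x, P (gen r x))
    (hadd : ∀ a b, P a → P b → P (a + b)) (hmul : ∀ a b, P a → P b → P (a * b))
    (a : Lambda r X) : P a := by
  obtain ⟨y, rfl⟩ := RingQuot.mkRingHom_surjective (LambdaRel r X) a
  induction y using FreeAlgebra.induction with
  | grade0 n =>
    have : RingQuot.mkRingHom (LambdaRel r X) (algebraMap ℤ _ n) = ((n : ℤ) : Lambda r X) := by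
      rw [eq_intCast (algebraMap ℤ (FreeAlgebra ℤ X)) n]
      exact map_intCast (RingQuot.mkRingHom (LambdaRel r X)) n
    rw [this]; exact hint n
  | grade1 x => exact hgen x
  | mul a b ha hb => rw [map_mul]; exact hmul _ _ ha hb
  | add a b ha hb => rw [map_add]; exact hadd _ _ ha hb

theorem hom_ext {T : Type*} [Ring T] {f g : Lambda r X →+* T}
    (h : ∀ x, f (gen r x) = g (gen r x)) : f = g := by
  ext a
  induction a using Lambda.induction with
  | hint n => simp
  | hgen x => exact h x
  | hadd a b ha hb => simp [ha, hb]
  | hmul a b ha hb => simp [ha, hb]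

/-- The ring homomorphism `Λ^r[X] → Λ^r[Y]` induced by a map of sets `X → Y`. -/
def map {Y : Type*} (f : X → Y) : Lambda r X →+* Lambda r Y :=
  lift (fun x => gen r (f x)) (fun _ _ => gen_comm _ _) (fun _ => gen_sq _)

@[simp] theorem map_gen {Y : Type*} (f : X → Y) (x : X) :
    map f (gen r x) = gen r (f x) := by simp [map]

end Lambda

/-! ### The Arnold classes, the Arnold ideal and the ring `R^r(Γ)` -/

/-- The product `e_w` of the generators of the edges of `w`, in order. -/
def edgeProd (r : ℕ) (w : List (E × Bool)) : Lambda r E :=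
  (w.map fun d => Lambda.gen r d.1).prod

/-- The sign of the `i`-th term of an Arnold class, for a step in the direction `b`:
`(-1) ^ i` if `r` is even, and `1` or `-1` according to the direction if `r` is odd. -/
def arnoldSign (r i : ℕ) (b : Bool) : ℤ :=
  if Even r then (-1) ^ i else (if b then 1 else -1)

/-- The Arnold class `A(w) = ∑ i, ± w_0 ⋯ ŵ_i ⋯ w_{k-1}`. Positions are counted from `0`, so
that a loop `w` (of length one, in the direction of its orientation) has `A(w) = 1`. -/
def arnold (r : ℕ) (w : List (E × Bool)) : Lambda r E :=
  ∑ i : Fin w.length, arnoldSign r i (w.get i).2 • edgeProd r (w.eraseIdx i)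

/-- The generalized Arnold ideal `I^r(Γ)`, generated by the Arnold classes of all circuits. -/
def arnoldIdeal (r : ℕ) (Γ : OGraph V E) : Ideal (Lambda r E) :=
  Ideal.span {x | ∃ w, Γ.IsCircuit w ∧ x = arnold r w}

theorem sgn_mul_sgn (r : ℕ) : sgn r * sgn r = 1 := by
  rcases neg_one_pow_eq_or ℤ (r + 1) with h | h <;> simp [sgn, h]

@[simp] theorem edgeProd_nil (r : ℕ) : edgeProd r ([] : List (E × Bool)) = 1 := rfl

@[simp] theorem edgeProd_cons (r : ℕ) (d : E × Bool) (w : List (E × Bool)) :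
    edgeProd r (d :: w) = Lambda.gen r d.1 * edgeProd r w := rfl

@[simp] theorem arnold_nil (r : ℕ) : arnold r ([] : List (E × Bool)) = 0 := by
  simp [arnold]

theorem arnold_cons (r : ℕ) (d : E × Bool) (w : List (E × Bool)) :
    arnold r (d :: w) =
      arnoldSign r 0 d.2 • edgeProd r w + sgn r • (Lambda.gen r d.1 * arnold r w) := by
  unfold arnold
  refine (Fin.sum_univ_succ (n := w.length) _).trans ?_
  simp only [List.length_cons, Fin.val_zero, List.get_eq_getElem, List.getElem_cons_zero,
    List.eraseIdx_zero, List.tail_cons, Fin.val_succ, List.getElem_cons_succ,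
    List.eraseIdx_cons_succ, edgeProd_cons, Finset.mul_sum, Finset.smul_sum, mul_smul_comm,
    smul_smul]
  congr 1
  refine Finset.sum_congr rfl fun i _ => ?_
  congr 1
  unfold arnoldSign sgn
  split_ifs with h
  · rw [(h.add_one).neg_one_pow]; ring
  all_goals
    rw [((Nat.not_even_iff_odd.mp h).add_one).neg_one_pow]; ring

theorem edgeProd_mul_gen (r : ℕ) (w : List (E × Bool)) (b : E) :
    edgeProd r w * Lambda.gen r b = sgn r ^ w.length • (Lambda.gen r b * edgeProd r w) := by
  induction w with
  | nil => simp
  | cons d w ih =>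
    rw [edgeProd_cons, mul_assoc, ih, mul_smul_comm, ← mul_assoc, Lambda.gen_comm d.1 b,
      smul_mul_assoc, smul_smul, mul_assoc, List.length_cons, pow_succ]

theorem arnold_mul_gen (r : ℕ) (w : List (E × Bool)) (b : E) :
    arnold r w * Lambda.gen r b = sgn r ^ (w.length + 1) • (Lambda.gen r b * arnold r w) := by
  induction w with
  | nil => simp
  | cons d w ih =>
    have h2 : sgn r ^ (w.length + 1 + 1) = sgn r ^ w.length := by
      rw [pow_succ, pow_succ, mul_assoc, sgn_mul_sgn, mul_one]
    rw [arnold_cons, add_mul, smul_mul_assoc, smul_mul_assoc, mul_assoc, ih, edgeProd_mul_gen,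
      mul_add, smul_add, List.length_cons, h2]
    congr 1
    · simp only [mul_smul_comm, smul_smul, mul_comm]
    · rw [mul_smul_comm, ← mul_assoc, Lambda.gen_comm d.1 b]
      simp only [smul_mul_assoc, mul_smul_comm, smul_smul, mul_assoc]
      congr 1
      rw [pow_succ, mul_assoc, sgn_mul_sgn, mul_one, mul_comm]

instance (r : ℕ) (Γ : OGraph V E) : (arnoldIdeal r Γ).IsTwoSided where
  mul_mem_of_left := by
    intro a b
    induction b using Lambda.induction generalizing a with
    | hint n =>
      intro h
      rw [← (Int.cast_commute n a).eq]
      exact Ideal.mul_mem_left _ _ h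
    | hgen x =>
      intro h
      unfold arnoldIdeal at h
      induction h using Submodule.span_induction with
      | mem y hy =>
        obtain ⟨w, hw, rfl⟩ := hy
        rw [arnold_mul_gen]
        have hm : arnold r w ∈ arnoldIdeal r Γ := Ideal.subset_span ⟨w, hw, rfl⟩
        exact zsmul_mem (Ideal.mul_mem_left _ _ hm) _
      | zero => simp
      | add y z _ _ hy hz => rw [add_mul]; exact add_mem hy hz
      | smul c y _ hy => rw [smul_eq_mul, mul_assoc]; exact Ideal.mul_mem_left _ _ hy
    | hadd b c hb hc => intro h; rw [mul_add]; exact add_mem (hb h) (hc h)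
    | hmul b c hb hc => intro h; rw [← mul_assoc]; exact hc (hb h)

/-- The ring `R^r(Γ) = Λ^r(Γ) / I^r(Γ)`. -/
def R (r : ℕ) (Γ : OGraph V E) : Type _ := Lambda r E ⧸ arnoldIdeal r Γ

instance (r : ℕ) (Γ : OGraph V E) : Ring (R r Γ) :=
  inferInstanceAs (Ring (Lambda r E ⧸ arnoldIdeal r Γ))

/-- The quotient map `Λ^r(Γ) → R^r(Γ)`. -/
def R.mk (r : ℕ) (Γ : OGraph V E) : Lambda r E →+* R r Γ := Ideal.Quotient.mk (arnoldIdeal r Γ)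

/-- The class of the generator of an edge in `R^r(Γ)`. -/
def R.gen (r : ℕ) (Γ : OGraph V E) (e : E) : R r Γ := R.mk r Γ (Lambda.gen r e)

theorem R.mk_surjective (r : ℕ) (Γ : OGraph V E) : Function.Surjective (R.mk r Γ) :=
  Ideal.Quotient.mk_surjective

theorem R.mk_arnold {r : ℕ} {Γ : OGraph V E} {w : List (E × Bool)} (hw : Γ.IsCircuit w) :
    R.mk r Γ (arnold r w) = 0 :=
  Ideal.Quotient.eq_zero_iff_mem.mpr (Ideal.subset_span ⟨w, hw, rfl⟩)

/-- A ring homomorphism out of `R^r(Γ)`, from one out of `Λ^r(Γ)` that kills the Arnold classes. -/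
def R.lift {r : ℕ} {Γ : OGraph V E} {T : Type*} [Ring T] (f : Lambda r E →+* T)
    (hf : ∀ w, Γ.IsCircuit w → f (arnold r w) = 0) : R r Γ →+* T :=
  Ideal.Quotient.lift (arnoldIdeal r Γ) f (by
    intro a ha
    unfold arnoldIdeal at ha
    induction ha using Submodule.span_induction with
    | mem y hy => obtain ⟨w, hw, rfl⟩ := hy; exact hf w hw
    | zero => simp
    | add y z _ _ hy hz => rw [map_add, hy, hz, add_zero]
    | smul c y _ hy => rw [smul_eq_mul, map_mul, hy, mul_zero])

@[simp] theorem R.lift_mk {r : ℕ} {Γ : OGraph V E} {T : Type*} [Ring T] (f : Lambda r E →+* T)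
    (hf : ∀ w, Γ.IsCircuit w → f (arnold r w) = 0) (x : Lambda r E) :
    R.lift (Γ := Γ) f hf (R.mk r Γ x) = f x := rfl

@[simp] theorem R.lift_gen {r : ℕ} {Γ : OGraph V E} {T : Type*} [Ring T] (f : Lambda r E →+* T)
    (hf : ∀ w, Γ.IsCircuit w → f (arnold r w) = 0) (e : E) :
    R.lift (Γ := Γ) f hf (R.gen r Γ e) = f (Lambda.gen r e) := rfl

/-! ### Maps induced by maps of graphs -/

theorem map_edgeProd (r : ℕ) (f : E → E') (w : List (E × Bool)) :
    Lambda.map f (edgeProd r w) = edgeProd r (w.map (Prod.map f id)) := by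
  induction w with
  | nil => simp
  | cons d w ih => simp [ih]

theorem map_arnold (r : ℕ) (f : E → E') (w : List (E × Bool)) :
    Lambda.map f (arnold r w) = arnold r (w.map (Prod.map f id)) := by
  induction w with
  | nil => simp
  | cons d w ih => simp [arnold_cons, ih, map_edgeProd]

theorem OGraph.IsWalk.map {Γ : OGraph V E} {Γ' : OGraph V' E'} {f : E → E'} {g : V → V'}
    (hs : ∀ e, Γ'.src (f e) = g (Γ.src e)) (ht : ∀ e, Γ'.tgt (f e) = g (Γ.tgt e))
    {w : List (E × Bool)} {u v : V} (h : Γ.IsWalk u w v) :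
    Γ'.IsWalk (g u) (w.map (Prod.map f id)) (g v) := by
  induction w generalizing u with
  | nil => exact congrArg g h
  | cons d w ih =>
    obtain ⟨e, b⟩ := d
    obtain ⟨rfl, h⟩ := h
    refine ⟨?_, ?_⟩
    · cases b <;> simp [start, hs, ht]
    · have := ih h
      cases b <;> simpa [finish, hs, ht] using this

/-- The map `R^r(Γ) → R^r(Γ')` induced by a map of graphs, given by a map `f` of edges and
a compatible map `g` of vertices. -/
def R.map (r : ℕ) {Γ : OGraph V E} {Γ' : OGraph V' E'} (f : E → E') (g : V → V')
    (hs : ∀ e, Γ'.src (f e) = g (Γ.src e)) (ht : ∀ e, Γ'.tgt (f e) = g (Γ.tgt e)) :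
    R r Γ →+* R r Γ' :=
  R.lift ((R.mk r Γ').comp (Lambda.map f)) (by
    rintro w ⟨hne, v, hw⟩
    rw [RingHom.comp_apply, map_arnold]
    exact R.mk_arnold ⟨by simpa using hne, g v, hw.map hs ht⟩)

/-- The map `i_α : R^r(Γ ∖ α) → R^r(Γ)` induced by the inclusion of graphs. -/
def deletionMap (r : ℕ) (Γ : OGraph V E) (α : E) : R r (Γ.delete α) →+* R r Γ :=
  R.map r Subtype.val id (fun _ => rfl) (fun _ => rfl)

/-- The map `p_α ∘ i_α : R^r(Γ ∖ α) → R^r(Γ / α)` induced by the map of graphs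
`Γ ∖ α ⊆ Γ → Γ / α`. -/
def deletionToContraction (r : ℕ) (Γ : OGraph V E) (α : E) :
    R r (Γ.delete α) →+* R r (Γ.contract α) :=
  R.map r id (Quot.mk _) (fun _ => rfl) (fun _ => rfl)

/-! ### Gradings -/

section WordGrading

variable {A : Type*} [Ring A] {X : Type*}

/-- If the ring `A` is generated by elements `g x` of degree `d`, then its part of degree `k` is
spanned by the products of `n` generators with `n * d = k`. -/
def wordGrading (d : ℤ) (g : X → A) (k : ℤ) : Submodule ℤ A :=
  Submodule.span ℤ {a | ∃ l : List X, (l.length : ℤ) * d = k ∧ (l.map g).prod = a}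

theorem prod_mem_wordGrading (d : ℤ) (g : X → A) (l : List X) :
    (l.map g).prod ∈ wordGrading d g (l.length * d) :=
  Submodule.subset_span ⟨l, rfl, rfl⟩

theorem gen_mem_wordGrading (d : ℤ) (g : X → A) (x : X) : g x ∈ wordGrading d g d := by
  have := prod_mem_wordGrading d g [x]
  simpa using this

instance (d : ℤ) (g : X → A) : SetLike.GradedMonoid (wordGrading d g) where
  one_mem := Submodule.subset_span ⟨[], by simp, by simp⟩
  mul_mem := by
    intro i j a b ha hb
    have h : a * b ∈ wordGrading d g i * wordGrading d g j := Submodule.mul_mem_mul ha hb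
    unfold wordGrading at h
    rw [Submodule.span_mul_span] at h
    refine Submodule.span_mono ?_ h
    rintro _ ⟨_, ⟨l, hl, rfl⟩, _, ⟨m, hm, rfl⟩, rfl⟩
    exact ⟨l ++ m, by simp [add_mul, hl, hm], by simp⟩

/-- The generator `g x` in the external direct sum of the homogeneous parts. -/
def wordGen (d : ℤ) (g : X → A) (x : X) : ⨁ k, wordGrading d g k :=
  DirectSum.of (fun k => wordGrading d g k) d ⟨g x, gen_mem_wordGrading d g x⟩

theorem of_eq_of_coe_eq {d : ℤ} {g : X → A} {i j : ℤ} (hij : i = j) {x : wordGrading d g i}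
    {y : wordGrading d g j} (h : (x : A) = y) :
    DirectSum.of (fun k => wordGrading d g k) i x = DirectSum.of _ j y := by
  subst hij
  rw [Subtype.ext h]

theorem prod_wordGen (d : ℤ) (g : X → A) (l : List X) :
    (l.map (wordGen d g)).prod =
      DirectSum.of (fun k => wordGrading d g k) _ ⟨_, prod_mem_wordGrading d g l⟩ := by
  induction l with
  | nil =>
    rw [List.map_nil, List.prod_nil, DirectSum.one_def]
    exact of_eq_of_coe_eq (by simp) rfl
  | cons x l ih =>
    rw [List.map_cons, List.prod_cons, ih, wordGen, DirectSum.of_mul_of]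
    exact of_eq_of_coe_eq (by simp; ring) rfl

/-- A ring homomorphism to the direct sum of the homogeneous parts which fixes the generators
shows that these parts do form a grading. -/
@[reducible] def wordGradedRing (d : ℤ) (g : X → A) (f : A →+* ⨁ k, wordGrading d g k)
    (hf : ∀ x, f (g x) = wordGen d g x)
    (hid : ∀ h : A →+* A, (∀ x, h (g x) = g x) → h = RingHom.id A) :
    GradedAlgebra (wordGrading d g) :=
  GradedAlgebra.ofAlgHom _ f.toIntAlgHom
    (by
      have h := hid ((DirectSum.coeAlgHom (wordGrading d g)).toRingHom.comp f) (by
        intro x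
        simp only [AlgHom.toRingHom_eq_coe, RingHom.coe_comp, RingHom.coe_coe,
          Function.comp_apply, hf, wordGen]
        exact DirectSum.coeAlgHom_of _ _ _)
      ext x
      exact RingHom.congr_fun h x)
    (by
      rintro k ⟨x, hx⟩
      have key : ∀ y (hy : y ∈ wordGrading d g k),
          f y = DirectSum.of (fun k => wordGrading d g k) k ⟨y, hy⟩ := by
        intro y hy
        have hy' := hy
        unfold wordGrading at hy'
        induction hy' using Submodule.span_induction with
        | mem y hm =>
          obtain ⟨l, hl, rfl⟩ := hm
          rw [map_list_prod, List.map_map]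
          have : (f ∘ g) = wordGen d g := funext hf
          rw [this, prod_wordGen]
          exact of_eq_of_coe_eq hl rfl
        | zero =>
          rw [map_zero]
          exact (map_zero (DirectSum.of (fun k => wordGrading d g k) k)).symm
        | add a b ha hb iha ihb =>
          rw [map_add, iha ha, ihb hb, ← map_add]
          rfl
        | smul n a ha iha =>
          rw [map_zsmul, iha ha, ← map_zsmul]
          rfl
      exact key x hx)

end WordGrading

/-- The grading of `Λ^r[X]`, with the generators in degree `r - 1`. -/
abbrev Lambda.grading (r : ℕ) (X : Type*) : ℤ → Submodule ℤ (Lambda r X) :=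
  wordGrading ((r : ℤ) - 1) (Lambda.gen r)

/-- The grading of `R^r(Γ)`, with the generators in degree `r - 1`. -/
abbrev R.grading (r : ℕ) (Γ : OGraph V E) : ℤ → Submodule ℤ (R r Γ) :=
  wordGrading ((r : ℤ) - 1) (R.gen r Γ)

theorem wordGen_comm {A : Type*} [Ring A] {X : Type*} (r : ℕ) (d : ℤ) (g : X → A)
    (hg : ∀ a b, g a * g b = sgn r • (g b * g a)) (a b : X) :
    wordGen d g a * wordGen d g b = sgn r • (wordGen d g b * wordGen d g a) := by
  simp only [wordGen, DirectSum.of_mul_of, ← map_zsmul]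
  exact of_eq_of_coe_eq rfl (hg a b)

theorem wordGen_sq {A : Type*} [Ring A] {X : Type*} (d : ℤ) (g : X → A)
    (hg : ∀ a, g a * g a = 0) (a : X) : wordGen d g a * wordGen d g a = 0 := by
  rw [wordGen, DirectSum.of_mul_of, ← map_zero (DirectSum.of (fun k => wordGrading d g k) (d + d))]
  exact of_eq_of_coe_eq rfl (hg a)

instance (r : ℕ) (X : Type*) : GradedAlgebra (Lambda.grading r X) :=
  wordGradedRing _ _
    (Lambda.lift (wordGen _ _) (wordGen_comm r _ _ Lambda.gen_comm) (wordGen_sq _ _ Lambda.gen_sq))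
    (fun x => Lambda.lift_gen _ _ _ x) (fun h hh => Lambda.hom_ext hh)

theorem R.gen_comm (r : ℕ) (Γ : OGraph V E) (a b : E) :
    R.gen r Γ a * R.gen r Γ b = sgn r • (R.gen r Γ b * R.gen r Γ a) := by
  simp only [R.gen, ← map_mul, ← map_zsmul, Lambda.gen_comm a b]

theorem R.gen_sq (r : ℕ) (Γ : OGraph V E) (a : E) : R.gen r Γ a * R.gen r Γ a = 0 := by
  simp only [R.gen, ← map_mul, Lambda.gen_sq a, map_zero]

theorem R.mk_edgeProd (r : ℕ) (Γ : OGraph V E) (w : List (E × Bool)) :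
    R.mk r Γ (edgeProd r w) = ((w.map Prod.fst).map (R.gen r Γ)).prod := by
  induction w with
  | nil => simp
  | cons d w ih => simp [ih, R.gen]

theorem mk_arnold_homogeneous (r : ℕ) (Γ : OGraph V E) (w : List (E × Bool)) :
    ∃ x : R.grading r Γ (((w.length : ℤ) - 1) * ((r : ℤ) - 1)), (x : R r Γ) = R.mk r Γ (arnold r w) ∧
      Lambda.lift (wordGen ((r : ℤ) - 1) (R.gen r Γ)) (wordGen_comm r _ _ (R.gen_comm r Γ))
        (wordGen_sq _ _ (R.gen_sq r Γ)) (arnold r w) =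
        DirectSum.of (fun k => R.grading r Γ k) _ x := by
  set F := Lambda.lift (wordGen ((r : ℤ) - 1) (R.gen r Γ)) (wordGen_comm r _ _ (R.gen_comm r Γ))
        (wordGen_sq _ _ (R.gen_sq r Γ)) with hF
  have hprod : ∀ w : List (E × Bool), F (edgeProd r w) =
      ((w.map Prod.fst).map (wordGen ((r : ℤ) - 1) (R.gen r Γ))).prod := by
    intro w
    induction w with
    | nil => simp
    | cons d w ih =>
      rw [edgeProd_cons, map_mul, ih, hF, Lambda.lift_gen]
      rfl
  induction w with
  | nil => exact ⟨0, by simp, by simp⟩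
  | cons d w ih =>
    obtain ⟨x, hx, hx'⟩ := ih
    have h1 : R.mk r Γ (edgeProd r w) ∈
        R.grading r Γ ((((d :: w).length : ℤ) - 1) * ((r : ℤ) - 1)) := by
      rw [R.mk_edgeProd]
      have := prod_mem_wordGrading ((r : ℤ) - 1) (R.gen r Γ) (w.map Prod.fst)
      simpa using this
    have hdeg : ((r : ℤ) - 1) + ((w.length : ℤ) - 1) * ((r : ℤ) - 1) =
        (((d :: w).length : ℤ) - 1) * ((r : ℤ) - 1) := by
      simp; ring
    have h2 : R.gen r Γ d.1 * (x : R r Γ) ∈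
        R.grading r Γ ((((d :: w).length : ℤ) - 1) * ((r : ℤ) - 1)) := by
      rw [← hdeg]
      exact SetLike.GradedMul.mul_mem (gen_mem_wordGrading _ _ _) x.2
    refine ⟨arnoldSign r 0 d.2 • ⟨_, h1⟩ + sgn r • ⟨_, h2⟩, ?_, ?_⟩
    · simp [arnold_cons, hx, R.gen]
    · rw [arnold_cons, map_add, map_zsmul, map_zsmul, map_mul, hx', hprod, prod_wordGen,
        hF, Lambda.lift_gen, wordGen, DirectSum.of_mul_of, map_add, map_zsmul, map_zsmul]
      congr 2
      · exact of_eq_of_coe_eq (by simp) (R.mk_edgeProd r Γ w).symm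
      · exact of_eq_of_coe_eq hdeg rfl

instance (r : ℕ) (Γ : OGraph V E) : GradedAlgebra (R.grading r Γ) :=
  wordGradedRing _ _
    (R.lift (Lambda.lift (wordGen _ _) (wordGen_comm r _ _ (R.gen_comm r Γ))
        (wordGen_sq _ _ (R.gen_sq r Γ))) (by
      intro w hw
      obtain ⟨x, hx, hx'⟩ := mk_arnold_homogeneous r Γ w
      rw [hx']
      rw [R.mk_arnold hw] at hx
      rw [show x = 0 from Subtype.ext hx, map_zero]))
    (fun x => by rw [R.lift_gen, Lambda.lift_gen])
    (fun _ hh => by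
      have := Lambda.hom_ext (f := RingHom.comp _ (R.mk r Γ)) (g := R.mk r Γ) hh
      ext y
      obtain ⟨z, rfl⟩ := R.mk_surjective r Γ y
      exact RingHom.congr_fun this z)

/-! ### The graded tensor product with `Λ^r[e_α]` and the map `ψ_α` -/

/-- The ring `R^r(Γ) ⊗ Λ^r[e]`, where `Λ^r[e]` is the algebra on a single generator `e` of degree
`r - 1`, and the tensor product is that of graded commutative rings: its product is
`(a ⊗ b) (a' ⊗ b') = (-1) ^ (deg b * deg a') • (a a' ⊗ b b')`. -/
abbrev RTensor (r : ℕ) (Γ : OGraph V E) : Type _ :=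
  R.grading r Γ ᵍ⊗[ℤ] Lambda.grading r Unit

/-- The map `ι : R^r(Γ) → R^r(Γ) ⊗ Λ^r[e]`, `x ↦ x ⊗ 1`. -/
def tensorInl (r : ℕ) (Γ : OGraph V E) : R r Γ →+* RTensor r Γ :=
  (GradedTensorProduct.includeLeft (R.grading r Γ) (Lambda.grading r Unit)).toRingHom

/-- The map `Λ^r[e] → R^r(Γ) ⊗ Λ^r[e]`, `y ↦ 1 ⊗ y`. -/
def tensorInr (r : ℕ) (Γ : OGraph V E) : Lambda r Unit →+* RTensor r Γ :=
  (GradedTensorProduct.includeRight (R.grading r Γ) (Lambda.grading r Unit)).toRingHom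

theorem neg_one_uzpow_eq_sgn (r : ℕ) :
    (((-1 : ℤˣ) ^ (((r : ℤ) - 1) * ((r : ℤ) - 1)) : ℤˣ) : ℤ) = sgn r := by
  have h : ∀ n : ℤ, (-1 : ℤˣ) ^ n = if Even n then 1 else -1 := by
    intro n
    split_ifs with hn
    · exact hn.neg_one_zpow
    · exact (Int.not_even_iff_odd.mp hn).neg_one_zpow
  rw [h]
  unfold sgn
  rcases Nat.even_or_odd r with hr | hr
  · have h1 : ¬ Even (((r : ℤ) - 1) * ((r : ℤ) - 1)) := by
      rw [Int.even_mul, or_self, Int.even_sub_one, not_not]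
      exact_mod_cast hr
    rw [if_neg h1, hr.add_one.neg_one_pow]
    rfl
  · have h1 : Even (((r : ℤ) - 1) * ((r : ℤ) - 1)) := by
      rw [Int.even_mul, or_self, Int.even_sub_one, Int.not_even_iff_odd]
      exact_mod_cast hr
    rw [if_pos h1, hr.add_one.neg_one_pow]
    rfl

theorem tensorInr_mul_tensorInl (r : ℕ) (Γ : OGraph V E) (e : E) (u : Unit) :
    tensorInr r Γ (Lambda.gen r u) * tensorInl r Γ (R.gen r Γ e) =
      sgn r • (tensorInl r Γ (R.gen r Γ e) * tensorInr r Γ (Lambda.gen r u)) := by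
  have h1 := GradedTensorProduct.tmul_coe_mul_coe_tmul (R.grading r Γ) (Lambda.grading r Unit)
    (1 : R r Γ) ⟨Lambda.gen r u, gen_mem_wordGrading ((r : ℤ) - 1) (Lambda.gen r) u⟩
    ⟨R.gen r Γ e, gen_mem_wordGrading ((r : ℤ) - 1) (R.gen r Γ) e⟩ (1 : Lambda r Unit)
  have h2 := GradedTensorProduct.tmul_one_mul_one_tmul (R.grading r Γ) (Lambda.grading r Unit)
    (R.gen r Γ e) (Lambda.gen r u)
  rw [Units.smul_def, neg_one_uzpow_eq_sgn, one_mul, mul_one] at h1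
  exact h1.trans (congrArg (sgn r • ·) h2.symm)

theorem tensorInl_mul_tensorInr (r : ℕ) (Γ : OGraph V E) (e : E) (u : Unit) :
    tensorInl r Γ (R.gen r Γ e) * tensorInr r Γ (Lambda.gen r u) =
      sgn r • (tensorInr r Γ (Lambda.gen r u) * tensorInl r Γ (R.gen r Γ e)) := by
  rw [tensorInr_mul_tensorInl, smul_smul, sgn_mul_sgn, one_smul]

open Classical in
/-- The images of the generators under `ψ_α`: `e_η ↦ e_η ⊗ 1` if `η ≠ α` and `e_α ↦ 1 ⊗ e_α`. -/
def psiGen (r : ℕ) (Γ : OGraph V E) (α : E) (e : E) : RTensor r (Γ.contract α) :=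
  if h : e = α then tensorInr r (Γ.contract α) (Lambda.gen r ())
  else tensorInl r (Γ.contract α) (R.gen r (Γ.contract α) ⟨e, h⟩)

/-- The map `Λ^r(Γ) → R^r(Γ / α) ⊗ Λ^r[e_α]` that induces `ψ_α`. -/
def psiLambda (r : ℕ) (Γ : OGraph V E) (α : E) : Lambda r E →+* RTensor r (Γ.contract α) :=
  Lambda.lift (psiGen r Γ α)
    (by
      intro a b
      unfold psiGen
      split_ifs with ha hb hb
      · rw [← map_mul, ← map_zsmul, ← Lambda.gen_comm]
      · exact tensorInr_mul_tensorInl _ _ _ _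
      · exact tensorInl_mul_tensorInr _ _ _ _
      · rw [← map_mul, ← map_mul, ← map_zsmul, ← R.gen_comm])
    (by
      intro a
      unfold psiGen
      split_ifs with ha
      · rw [← map_mul, Lambda.gen_sq, map_zero]
      · rw [← map_mul, R.gen_sq, map_zero])

open Classical in
/-- The steps of `w` along the edges different from `α`. -/
def dropEdge (α : E) (w : List (E × Bool)) : List ({e : E // e ≠ α} × Bool) :=
  w.filterMap fun d => if h : d.1 = α then none else some (⟨d.1, h⟩, d.2)

theorem isWalk_dropEdge {Γ : OGraph V E} (α : E) {w : List (E × Bool)} {u v : V}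
    (h : Γ.IsWalk u w v) :
    (Γ.contract α).IsWalk (Quot.mk _ u) (dropEdge α w) (Quot.mk _ v) := by
  induction w generalizing u with
  | nil => exact congrArg _ h
  | cons d w ih =>
    obtain ⟨e, b⟩ := d
    obtain ⟨rfl, h⟩ := h
    have ih := ih h
    by_cases he : e = α
    · subst he
      have hq : (Quot.mk _ (Γ.src e) : Γ.ContractVertex e) = Quot.mk _ (Γ.tgt e) :=
        Quot.sound ⟨rfl, rfl⟩
      have : dropEdge e ((e, b) :: w) = dropEdge e w := by simp [dropEdge]
      rw [this]
      cases b
      · simpa [OGraph.start, OGraph.finish, hq] using ih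
      · simpa [OGraph.start, OGraph.finish, hq] using ih
    · have : dropEdge α ((e, b) :: w) = (⟨e, he⟩, b) :: dropEdge α w := by simp [dropEdge, he]
      rw [this]
      refine ⟨?_, ?_⟩
      · cases b <;> rfl
      · cases b <;> exact ih

/-- The ring endomorphism of `Λ^r[X]` that multiplies each generator by `(-1) ^ (r - 1)`. -/
def Lambda.twist (r : ℕ) (X : Type*) : Lambda r X →+* Lambda r X :=
  Lambda.lift (fun x => sgn r • Lambda.gen r x)
    (by
      intro a b
      simp only [smul_mul_assoc, mul_smul_comm]
      rw [Lambda.gen_comm a b])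
    (by
      intro a
      simp only [smul_mul_assoc, mul_smul_comm]
      rw [Lambda.gen_sq a, smul_zero, smul_zero])

theorem Lambda.twist_gen (r : ℕ) {X : Type*} (x : X) :
    Lambda.twist r X (Lambda.gen r x) = sgn r • Lambda.gen r x := Lambda.lift_gen _ _ _ x

theorem Lambda.twist_twist (r : ℕ) {X : Type*} (y : Lambda r X) :
    Lambda.twist r X (Lambda.twist r X y) = y := by
  have : (Lambda.twist r X).comp (Lambda.twist r X) = RingHom.id _ := by
    apply Lambda.hom_ext
    intro x
    rw [RingHom.comp_apply, twist_gen, map_zsmul, twist_gen, smul_smul, sgn_mul_sgn, one_smul]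
    rfl
  exact RingHom.congr_fun this y

theorem tensorInl_mul_tensorInr_twist (r : ℕ) (Γ : OGraph V E) (e : E) (y : Lambda r Unit) :
    tensorInl r Γ (R.gen r Γ e) * tensorInr r Γ y =
      tensorInr r Γ (Lambda.twist r Unit y) * tensorInl r Γ (R.gen r Γ e) := by
  induction y using Lambda.induction with
  | hint n => simp only [map_intCast]; exact (Int.cast_commute n _).eq.symm
  | hgen x => rw [tensorInl_mul_tensorInr, Lambda.twist_gen, map_zsmul, smul_mul_assoc]
  | hadd a b ha hb => simp only [map_add, mul_add, add_mul, ha, hb]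
  | hmul a b ha hb => rw [map_mul, ← mul_assoc, ha, mul_assoc, hb, ← mul_assoc, map_mul, map_mul]

theorem mul_zsmul_right {T : Type*} [Ring T] (n : ℤ) (a b : T) : a * (n • b) = n • (a * b) :=
  mul_smul_comm n a b

theorem exists_psiLambda_eq (r : ℕ) (Γ : OGraph V E) (α : E) (w : List (E × Bool)) :
    ∃ p c : Lambda r Unit,
      psiLambda r Γ α (edgeProd r w) = tensorInr r (Γ.contract α) p *
        tensorInl r (Γ.contract α) (R.mk r (Γ.contract α) (edgeProd r (dropEdge α w))) ∧
      psiLambda r Γ α (arnold r w) =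
        tensorInr r (Γ.contract α) (Lambda.twist r Unit p) *
          tensorInl r (Γ.contract α) (R.mk r (Γ.contract α) (arnold r (dropEdge α w))) +
        tensorInr r (Γ.contract α) c *
          tensorInl r (Γ.contract α) (R.mk r (Γ.contract α) (edgeProd r (dropEdge α w))) := by
  induction w with
  | nil => exact ⟨1, 0, by simp [dropEdge], by simp [dropEdge]⟩
  | cons d w ih =>
    obtain ⟨e, b⟩ := d
    obtain ⟨p, c, h1, h2⟩ := ih
    by_cases he : e = α
    · subst he
      have hd : dropEdge e ((e, b) :: w) = dropEdge e w := by simp [dropEdge]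
      have hg : psiLambda r Γ e (Lambda.gen r e) =
          tensorInr r (Γ.contract e) (Lambda.gen r ()) := by simp [psiLambda, psiGen]
      refine ⟨Lambda.gen r () * p, arnoldSign r 0 b • p + sgn r • (Lambda.gen r () * c), ?_, ?_⟩
      · rw [hd, edgeProd_cons, map_mul, h1, hg, map_mul, mul_assoc]
      · rw [hd, arnold_cons, map_add, map_zsmul, map_zsmul, map_mul, h1, h2, hg]
        simp only [map_mul, map_add, map_zsmul, Lambda.twist_gen, add_mul, mul_add, smul_mul_assoc,
          smul_add, mul_assoc]
        abel
    · have hd : dropEdge α ((e, b) :: w) = (⟨e, he⟩, b) :: dropEdge α w := by simp [dropEdge, he]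
      have hg : psiLambda r Γ α (Lambda.gen r e) =
          tensorInl r (Γ.contract α) (R.gen r (Γ.contract α) ⟨e, he⟩) := by
        simp [psiLambda, psiGen, he]
      refine ⟨Lambda.twist r Unit p, sgn r • Lambda.twist r Unit c, ?_, ?_⟩
      · rw [hd, edgeProd_cons, edgeProd_cons, map_mul, h1, hg, ← mul_assoc,
          tensorInl_mul_tensorInr_twist, mul_assoc, map_mul, map_mul]
        rfl
      · rw [hd, arnold_cons, arnold_cons, edgeProd_cons, map_add, map_zsmul, map_zsmul, map_mul,
          h1, h2, hg, mul_add, ← mul_assoc, ← mul_assoc, tensorInl_mul_tensorInr_twist,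
          tensorInl_mul_tensorInr_twist, Lambda.twist_twist]
        simp only [map_mul, map_add, map_zsmul, mul_add, smul_mul_assoc, mul_zsmul_right,
          smul_add, mul_assoc, R.gen, add_assoc]

theorem mk_edgeProd_eq_zero {r : ℕ} {Γ : OGraph V E} {w : List (E × Bool)}
    (hw : Γ.IsCircuit w) : R.mk r Γ (edgeProd r w) = 0 := by
  obtain ⟨d, w, rfl⟩ := List.exists_cons_of_ne_nil hw.1
  have h : Lambda.gen r d.1 * arnold r (d :: w) = arnoldSign r 0 d.2 • edgeProd r (d :: w) := by
    rw [arnold_cons, mul_add, mul_smul_comm, mul_smul_comm, ← mul_assoc, Lambda.gen_sq, zero_mul,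
      smul_zero, add_zero, edgeProd_cons]
  have h' := congrArg (R.mk r Γ) h
  rw [map_mul, R.mk_arnold hw, mul_zero, map_zsmul] at h'
  have hs : arnoldSign r 0 d.2 * arnoldSign r 0 d.2 = 1 := by
    unfold arnoldSign
    split_ifs <;> simp
  rw [← one_smul ℤ (R.mk r Γ (edgeProd r (d :: w))), ← hs, mul_smul, ← h', smul_zero]

theorem arnold_eq_zero_of_dropEdge_eq_nil {r : ℕ} {Γ : OGraph V E} {α : E}
    (hα : Γ.src α ≠ Γ.tgt α) {w : List (E × Bool)} {v : V} (hw : Γ.IsWalk v w v)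
    (h : dropEdge α w = []) : arnold r w = 0 := by
  have hall : ∀ d ∈ w, d.1 = α := by
    intro d hd
    by_contra hne
    have : (⟨⟨d.1, hne⟩, d.2⟩ : {e : E // e ≠ α} × Bool) ∈ dropEdge α w :=
      List.mem_filterMap.mpr ⟨d, hd, by simp [hne]⟩
    rw [h] at this
    exact List.not_mem_nil this
  match w, hw, hall with
  | [], _, _ => simp
  | [(a, b)], hw, hall =>
    obtain rfl : a = α := hall (a, b) (by simp)
    obtain ⟨h1, h2⟩ := hw
    cases b
    · exact absurd (h2.trans h1.symm) hα
    · exact absurd (h1.trans h2.symm) hα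
  | [(a, b), (a', b')], hw, hall =>
    obtain rfl : a = α := hall (a, b) (by simp)
    obtain rfl : a' = a := hall (a', b') (by simp)
    obtain ⟨h1, h2, h3⟩ := hw
    have hb : b' = !b := by
      cases b <;> cases b' <;> simp_all [OGraph.start, OGraph.finish]
    subst hb
    simp only [arnold_cons, arnold_nil, edgeProd_cons, edgeProd_nil, mul_one, mul_zero, smul_zero,
      add_zero, mul_smul_comm, smul_smul, ← add_smul]
    have : arnoldSign r 0 b + sgn r * arnoldSign r 0 (!b) = 0 := by
      unfold arnoldSign sgn
      split_ifs with hr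
      · rw [hr.add_one.neg_one_pow]; simp
      all_goals
        rw [(Nat.not_even_iff_odd.mp hr).add_one.neg_one_pow]; simp_all
    rw [this, zero_smul]
  | (a, b) :: (a', b') :: (a'', b'') :: w, _, hall =>
    obtain rfl : a = α := hall (a, b) (by simp)
    obtain rfl : a' = a := hall (a', b') (by simp)
    obtain rfl : a'' = a' := hall (a'', b'') (by simp)
    simp only [arnold_cons, edgeProd_cons, mul_add, mul_smul_comm, ← mul_assoc, Lambda.gen_sq,
      zero_mul, smul_zero, add_zero]

/-- The map `ψ_α : R^r(Γ) → R^r(Γ / α) ⊗ Λ^r[e_α]`, for an edge `α` that is not a loop. On the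
generators it is given by `e_η ↦ e_η ⊗ 1` if `η ≠ α`, and `e_α ↦ 1 ⊗ e_α`. -/
def psi (r : ℕ) (Γ : OGraph V E) (α : E) (hα : Γ.src α ≠ Γ.tgt α) :
    R r Γ →+* RTensor r (Γ.contract α) :=
  R.lift (psiLambda r Γ α) (by
    rintro w ⟨-, v, hw⟩
    by_cases h : dropEdge α w = []
    · rw [arnold_eq_zero_of_dropEdge_eq_nil hα hw h, map_zero]
    · have hc : (Γ.contract α).IsCircuit (dropEdge α w) := ⟨h, _, isWalk_dropEdge α hw⟩
      obtain ⟨p, c, -, h2⟩ := exists_psiLambda_eq r Γ α w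
      rw [h2, R.mk_arnold hc, mk_edgeProd_eq_zero hc]
      simp)

end GraphRing

end

/-!
Since `Λ^r[e_α]` has the basis `1, e_α`, the coefficient of `e_α` in `ψ_α x` defines the residue of
`x` along `α`, an additive map `R^r(Γ) → R^r(Γ / α)`. It sends `i_α a + i_α b * e_α` to `q_α b`, and
the theorem amounts to the exactness of `0 → R^r(Γ ∖ α) → R^r(Γ) → R^r(Γ / α) → 0`.

Exactness in the middle: a circuit of `Γ / α` is a concatenation of walks of `Γ ∖ α` between the
ends of `α`. Either such a walk is closed, or it is closed up by `α`, and the Arnold relation of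
the resulting circuit shows that the product of `e_α` and the Arnold class of the walk comes from
`R^r(Γ ∖ α)`.

Injectivity of `i_α`, for a finite graph, is by induction on the number of edges. A loop kills the
ring, and a generator can be removed if it belongs to a pair of parallel edges. In a simple graph,
the residues of an element of the kernel along the edges `δ ≠ α` vanish, by induction applied to
`Γ / δ`. By exactness in the middle the element then comes from smaller and smaller subgraphs, so it
is an integer, and `ℤ → R^r(Γ)` is split by the augmentation. The general case follows since only
finitely many edges occur in an equality in `R^r(Γ)`.
-/

noncomputable section

namespace GraphRing

section

variable {V V' E E' : Type*} {r : ℕ} {Γ : OGraph V E} {Γ' : OGraph V' E'}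

theorem R.induction {P : R r Γ → Prop} (hint : ∀ n : ℤ, P n) (hgen : ∀ e, P (R.gen r Γ e))
    (hadd : ∀ a b, P a → P b → P (a + b)) (hmul : ∀ a b, P a → P b → P (a * b))
    (a : R r Γ) : P a := by
  obtain ⟨z, rfl⟩ := R.mk_surjective r Γ a
  induction z using Lambda.induction with
  | hint n => simpa only [map_intCast] using hint n
  | hgen e => exact hgen e
  | hadd a b ha hb => simpa only [map_add] using hadd _ _ ha hb
  | hmul a b ha hb => simpa only [map_mul] using hmul _ _ ha hb

theorem R.hom_ext {T : Type*} [Ring T] {f g : R r Γ →+* T}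
    (h : ∀ e, f (R.gen r Γ e) = g (R.gen r Γ e)) : f = g := by
  ext a
  obtain ⟨z, rfl⟩ := R.mk_surjective r Γ a
  exact RingHom.congr_fun (Lambda.hom_ext (f := f.comp (R.mk r Γ)) (g := g.comp (R.mk r Γ)) h) z

theorem R.map_mk (f : E → E') (g : V → V') (hs : ∀ e, Γ'.src (f e) = g (Γ.src e))
    (ht : ∀ e, Γ'.tgt (f e) = g (Γ.tgt e)) (z : Lambda r E) :
    R.map r f g hs ht (R.mk r Γ z) = R.mk r Γ' (Lambda.map f z) :=
  rfl

@[simp] theorem R.map_gen (f : E → E') (g : V → V') (hs : ∀ e, Γ'.src (f e) = g (Γ.src e))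
    (ht : ∀ e, Γ'.tgt (f e) = g (Γ.tgt e)) (e : E) :
    R.map r f g hs ht (R.gen r Γ e) = R.gen r Γ' (f e) := by
  rw [R.gen, R.map_mk, Lambda.map_gen, R.gen]

theorem R.mk_arnold_of_isWalk {v : V} {w : List (E × Bool)} (hw : Γ.IsWalk v w v) :
    R.mk r Γ (arnold r w) = 0 := by
  rcases eq_or_ne w [] with rfl | hne
  · rw [arnold_nil, map_zero]
  · exact R.mk_arnold ⟨hne, v, hw⟩

theorem mk_mem_range_deletionMap {α : E} (z : Lambda r {e : E // e ≠ α}) :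
    R.mk r Γ (Lambda.map Subtype.val z) ∈ (deletionMap r Γ α).range :=
  ⟨R.mk r _ z, R.map_mk ..⟩

@[simp] theorem deletionMap_gen {α : E} (e : {e : E // e ≠ α}) :
    deletionMap r Γ α (R.gen r _ e) = R.gen r Γ e :=
  R.map_gen ..

@[simp] theorem deletionToContraction_gen {α : E} (e : {e : E // e ≠ α}) :
    deletionToContraction r Γ α (R.gen r _ e) = R.gen r _ e :=
  R.map_gen ..

theorem deletionToContraction_mk {α : E} (z : Lambda r {e : E // e ≠ α}) :
    deletionToContraction r Γ α (R.mk r _ z) = R.mk r _ z := by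
  refine RingHom.congr_fun (f := (deletionToContraction r Γ α).comp (R.mk r _)) ?_ z
  exact Lambda.hom_ext fun e => deletionToContraction_gen e

theorem psi_gen_self {α : E} (hα : Γ.src α ≠ Γ.tgt α) :
    psi r Γ α hα (R.gen r Γ α) = tensorInr r _ (Lambda.gen r ()) := by
  simp [psi, psiLambda, psiGen]

theorem psi_deletionMap {α : E} (hα : Γ.src α ≠ Γ.tgt α) (a : R r (Γ.delete α)) :
    psi r Γ α hα (deletionMap r Γ α a) = tensorInl r _ (deletionToContraction r Γ α a) := by
  refine RingHom.congr_fun (f := (psi r Γ α hα).comp (deletionMap r Γ α))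
    (g := (tensorInl r _).comp (deletionToContraction r Γ α)) (R.hom_ext fun e => ?_) a
  simp [psi, psiLambda, psiGen, e.2]

theorem exists_gen_mul_deletionMap (α : E) (a : R r (Γ.delete α)) :
    ∃ a' : R r (Γ.delete α), R.gen r Γ α * deletionMap r Γ α a =
      deletionMap r Γ α a' * R.gen r Γ α := by
  induction a using R.induction with
  | hint n => exact ⟨n, by simpa only [map_intCast] using (Int.cast_commute n _).eq.symm⟩
  | hgen e =>
    exact ⟨sgn r • R.gen r _ e, by
      rw [map_zsmul, deletionMap_gen, R.gen_comm, smul_mul_assoc]⟩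
  | hadd a b ha hb =>
    obtain ⟨a', ha⟩ := ha
    obtain ⟨b', hb⟩ := hb
    exact ⟨a' + b', by rw [map_add, map_add, mul_add, add_mul, ha, hb]⟩
  | hmul a b ha hb =>
    obtain ⟨a', ha⟩ := ha
    obtain ⟨b', hb⟩ := hb
    exact ⟨a' * b', by rw [map_mul, map_mul, ← mul_assoc, ha, mul_assoc, hb, mul_assoc]⟩

theorem exists_deletionMap_add_mul_gen (α : E) (x : R r Γ) :
    ∃ a b : R r (Γ.delete α), x = deletionMap r Γ α a + deletionMap r Γ α b * R.gen r Γ α := by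
  classical
  induction x using R.induction with
  | hint n => exact ⟨n, 0, by simp⟩
  | hgen e =>
    by_cases he : e = α
    · exact ⟨0, 1, by simp [he]⟩
    · exact ⟨R.gen r _ ⟨e, he⟩, 0, by simp⟩
  | hadd x y hx hy =>
    obtain ⟨a, b, rfl⟩ := hx
    obtain ⟨c, d, rfl⟩ := hy
    exact ⟨a + c, b + d, by simp only [map_add, add_mul]; abel⟩
  | hmul x y hx hy =>
    obtain ⟨a, b, rfl⟩ := hx
    obtain ⟨c, d, rfl⟩ := hy
    obtain ⟨c', hc⟩ := exists_gen_mul_deletionMap α c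
    obtain ⟨d', hd⟩ := exists_gen_mul_deletionMap α d
    refine ⟨a * c, a * d + b * c', ?_⟩
    simp only [map_add, map_mul, add_mul, mul_add, mul_assoc, hc]
    rw [← mul_assoc (R.gen r Γ α) (deletionMap r Γ α d), hd, mul_assoc, R.gen_sq]
    simp only [mul_zero, add_zero]
    abel

end

/-! ### The residue along an edge -/

section

variable {V E : Type*} {r : ℕ} {Γ : OGraph V E} {α : E}

theorem tensorInl_mul_tensorInr_eq_tmul (a : R r Γ) (b : Lambda r Unit) :
    tensorInl r Γ a * tensorInr r Γ b =
      GradedTensorProduct.tmul ℤ (𝒜 := R.grading r Γ) (ℬ := Lambda.grading r Unit) a b :=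
  GradedTensorProduct.tmul_one_mul_one_tmul _ _ a b

/-- The map `R^r(Γ) ⊗ Λ^r[e] → R^r(Γ)` that applies a linear form to the second factor. -/
def tensorEval (r : ℕ) (Γ : OGraph V E) (f : Lambda r Unit →ₗ[ℤ] ℤ) :
    RTensor r Γ →ₗ[ℤ] R r Γ :=
  (TensorProduct.rid ℤ (R r Γ)).toLinearMap ∘ₗ LinearMap.lTensor (R r Γ) f ∘ₗ
    (GradedTensorProduct.of ℤ (R.grading r Γ) (Lambda.grading r Unit)).symm.toLinearMap

theorem tensorEval_mul (f : Lambda r Unit →ₗ[ℤ] ℤ) (a : R r Γ) (b : Lambda r Unit) :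
    tensorEval r Γ f (tensorInl r Γ a * tensorInr r Γ b) = f b • a := by
  rw [tensorInl_mul_tensorInr_eq_tmul]
  rfl

theorem tensorEval_tensorInl (f : Lambda r Unit →ₗ[ℤ] ℤ) (a : R r Γ) :
    tensorEval r Γ f (tensorInl r Γ a) = f 1 • a := by
  rw [← tensorEval_mul, map_one, mul_one]

/-- The map `Λ^r[e] → ℤ[ε]`, `e ↦ ε`, to the dual numbers. It is used to read off the two
coefficients of an element of `Λ^r[e]`. -/
def toDualNumber (r : ℕ) : Lambda r Unit →+* DualNumber ℤ :=
  Lambda.lift (fun _ => DualNumber.eps) (by simp) (by simp)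

/-- The constant coefficient of an element of `Λ^r[e]`. -/
def constCoeff (r : ℕ) : Lambda r Unit →ₗ[ℤ] ℤ :=
  (TrivSqZeroExt.fstHom ℤ ℤ ℤ).toLinearMap ∘ₗ (toDualNumber r).toIntAlgHom.toLinearMap

/-- The coefficient of `e` in an element of `Λ^r[e]`. -/
def genCoeff (r : ℕ) : Lambda r Unit →ₗ[ℤ] ℤ :=
  TrivSqZeroExt.sndHom ℤ ℤ ∘ₗ (toDualNumber r).toIntAlgHom.toLinearMap

theorem constCoeff_one (r : ℕ) : constCoeff r 1 = 1 := by
  simp [constCoeff]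

theorem genCoeff_one (r : ℕ) : genCoeff r 1 = 0 := by
  simp [genCoeff]

theorem genCoeff_gen (r : ℕ) : genCoeff r (Lambda.gen r ()) = 1 := by
  simp [genCoeff, toDualNumber]

theorem tensorInl_injective (r : ℕ) (Γ : OGraph V E) : Function.Injective (tensorInl r Γ) := by
  intro a b h
  simpa only [tensorEval_tensorInl, constCoeff_one, one_smul] using
    congrArg (tensorEval r Γ (constCoeff r)) h

/-- The residue of `x` along `α`, which is the coefficient of `e_α` in `ψ_α x`. -/
def residue (r : ℕ) (Γ : OGraph V E) (α : E) (hα : Γ.src α ≠ Γ.tgt α) :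
    R r Γ →+ R r (Γ.contract α) :=
  (tensorEval r _ (genCoeff r)).toAddMonoidHom.comp (psi r Γ α hα).toAddMonoidHom

theorem residue_eq (hα : Γ.src α ≠ Γ.tgt α) (x : R r Γ) :
    residue r Γ α hα x = tensorEval r _ (genCoeff r) (psi r Γ α hα x) :=
  rfl

theorem residue_eq_zero_of_psi_eq_tensorInl (hα : Γ.src α ≠ Γ.tgt α) {x : R r Γ}
    {y : R r (Γ.contract α)} (h : psi r Γ α hα x = tensorInl r _ y) :
    residue r Γ α hα x = 0 := by
  rw [residue_eq, h, tensorEval_tensorInl, genCoeff_one, zero_smul]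

@[simp] theorem residue_deletionMap (hα : Γ.src α ≠ Γ.tgt α) (a : R r (Γ.delete α)) :
    residue r Γ α hα (deletionMap r Γ α a) = 0 :=
  residue_eq_zero_of_psi_eq_tensorInl hα (psi_deletionMap hα a)

@[simp] theorem residue_deletionMap_mul_gen (hα : Γ.src α ≠ Γ.tgt α) (b : R r (Γ.delete α)) :
    residue r Γ α hα (deletionMap r Γ α b * R.gen r Γ α) = deletionToContraction r Γ α b := by
  rw [residue_eq, map_mul, psi_deletionMap, psi_gen_self, tensorEval_mul, genCoeff_gen, one_smul]

theorem psi_surjective (hα : Γ.src α ≠ Γ.tgt α) : Function.Surjective (psi r Γ α hα) := by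
  have hinl (y : R r (Γ.contract α)) : tensorInl r _ y ∈ (psi r Γ α hα).range := by
    obtain ⟨z, rfl⟩ := R.mk_surjective r _ y
    exact ⟨deletionMap r Γ α (R.mk r _ z), by rw [psi_deletionMap, deletionToContraction_mk]⟩
  have hinr (b : Lambda r Unit) : tensorInr r _ b ∈ (psi r Γ α hα).range := by
    induction b using Lambda.induction with
    | hint n => exact map_intCast (tensorInr r (Γ.contract α)) n ▸ intCast_mem _ n
    | hgen u => exact ⟨R.gen r Γ α, psi_gen_self hα⟩
    | hadd a b ha hb => rw [map_add]; exact add_mem ha hb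
    | hmul a b ha hb => rw [map_mul]; exact mul_mem ha hb
  intro t
  change t ∈ (psi r Γ α hα).range
  induction t using TensorProduct.induction_on with
  | zero => exact zero_mem _
  | tmul a b =>
    have h := mul_mem (hinl a) (hinr b)
    rwa [tensorInl_mul_tensorInr_eq_tmul] at h
  | add x y hx hy => exact add_mem hx hy

end

/-! ### The kernel of the residue -/

section

variable {V E : Type*} {r : ℕ} {Γ : OGraph V E} {α : E}

theorem edgeProd_append (r : ℕ) (u v : List (E × Bool)) :
    edgeProd r (u ++ v) = edgeProd r u * edgeProd r v := by
  simp [edgeProd]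

theorem arnold_append (r : ℕ) (u v : List (E × Bool)) :
    arnold r (u ++ v) =
      arnold r u * edgeProd r v + sgn r ^ u.length • (edgeProd r u * arnold r v) := by
  induction u with
  | nil => simp
  | cons d u ih =>
    rw [List.cons_append, arnold_cons, ih, edgeProd_append, arnold_cons, edgeProd_cons,
      List.length_cons, pow_succ']
    simp only [mul_add, add_mul, smul_add, smul_mul_assoc, mul_smul_comm, mul_assoc, smul_smul,
      add_assoc]

theorem arnold_mul_edgeProd (r : ℕ) (u v : List (E × Bool)) :
    arnold r u * edgeProd r v =
      sgn r ^ ((u.length + 1) * v.length) • (edgeProd r v * arnold r u) := by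
  induction v with
  | nil => simp
  | cons d v ih =>
    rw [edgeProd_cons, ← mul_assoc, arnold_mul_gen, smul_mul_assoc, mul_assoc, ih, mul_smul_comm,
      smul_smul, mul_assoc, ← pow_add, List.length_cons]
    congr 2
    ring

theorem arnold_append_comm (r : ℕ) (u v : List (E × Bool)) :
    arnold r (v ++ u) = sgn r ^ (u.length * v.length) • arnold r (u ++ v) := by
  have h (n : ℕ) : sgn r ^ n * sgn r ^ n = 1 := by rw [← mul_pow, sgn_mul_sgn, one_pow]
  rw [arnold_append, arnold_append, arnold_mul_edgeProd r v u, arnold_mul_edgeProd r u v,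
    smul_add, smul_smul, smul_smul, add_comm]
  congr 2
  · rw [add_mul, one_mul, pow_add, ← mul_assoc, h, one_mul]
  · ring

theorem OGraph.isWalk_append {p q : List (E × Bool)} {u v : V} :
    Γ.IsWalk u (p ++ q) v ↔ ∃ x, Γ.IsWalk u p x ∧ Γ.IsWalk x q v := by
  induction p generalizing u with
  | nil => simp [IsWalk]
  | cons d p ih => simp [IsWalk, ih, and_assoc]

theorem OGraph.contract_start (d : {e : E // e ≠ α} × Bool) :
    (Γ.contract α).start d = Quot.mk _ ((Γ.delete α).start d) := by
  rcases d with ⟨e, _ | _⟩ <;> rfl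

theorem OGraph.contract_finish (d : {e : E // e ≠ α} × Bool) :
    (Γ.contract α).finish d = Quot.mk _ ((Γ.delete α).finish d) := by
  rcases d with ⟨e, _ | _⟩ <;> rfl

/-- The vertex `v` is one of the two ends of the edge `e`. -/
def OGraph.IsEnd (Γ : OGraph V E) (e : E) (v : V) : Prop := v = Γ.src e ∨ v = Γ.tgt e

theorem OGraph.eq_or_isEnd_of_mk_eq {u v : V}
    (h : (Quot.mk _ u : Γ.ContractVertex α) = Quot.mk _ v) :
    u = v ∨ Γ.IsEnd α u ∧ Γ.IsEnd α v := by
  classical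
  have h' := congrArg (Quot.lift (fun v => if v = Γ.tgt α then Γ.src α else v) (by
    rintro a b ⟨rfl, rfl⟩
    simp)) h
  simp only at h'
  split_ifs at h' with h1 h2 h2
  · exact Or.inl (h1.trans h2.symm)
  · exact Or.inr ⟨Or.inr h1, Or.inl h'.symm⟩
  · exact Or.inr ⟨Or.inl h', Or.inr h2⟩
  · exact Or.inl h'

theorem OGraph.IsEnd.mk_eq {v : V} (h : Γ.IsEnd α v) :
    (Quot.mk _ v : Γ.ContractVertex α) = Quot.mk _ (Γ.src α) := by
  rcases h with rfl | rfl
  · rfl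
  · exact (Quot.sound ⟨rfl, rfl⟩).symm

theorem OGraph.IsEnd.eq_or_exists_step {u v : V} (hu : Γ.IsEnd α u) (hv : Γ.IsEnd α v) :
    u = v ∨ ∃ b, Γ.start (α, b) = v ∧ Γ.finish (α, b) = u := by
  rcases hu with rfl | rfl <;> rcases hv with rfl | rfl
  · exact Or.inl rfl
  · exact Or.inr ⟨false, rfl, rfl⟩
  · exact Or.inr ⟨true, rfl, rfl⟩
  · exact Or.inl rfl

theorem OGraph.isWalk_delete_or_exists_append {w : List ({e : E // e ≠ α} × Bool)} {u v : V}
    (hw : (Γ.contract α).IsWalk (Quot.mk _ u) w (Quot.mk _ v)) :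
    (Γ.delete α).IsWalk u w v ∨ ∃ w₁ w₂, w = w₁ ++ w₂ ∧
      (Γ.contract α).IsWalk (Quot.mk _ u) w₁ (Quot.mk _ (Γ.src α)) ∧
      (Γ.contract α).IsWalk (Quot.mk _ (Γ.src α)) w₂ (Quot.mk _ v) := by
  induction w generalizing u with
  | nil =>
    rcases eq_or_isEnd_of_mk_eq hw with h | ⟨hu, hv⟩
    · exact Or.inl h
    · exact Or.inr ⟨[], [], rfl, hu.mk_eq, hv.mk_eq.symm⟩
  | cons d w ih =>
    obtain ⟨h1, h2⟩ := id hw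
    rw [contract_start] at h1
    rw [contract_finish] at h2
    rcases eq_or_isEnd_of_mk_eq h1 with h | ⟨-, hu⟩
    · rcases ih h2 with h' | ⟨w₁, w₂, rfl, h₁, h₂⟩
      · exact Or.inl ⟨h, h'⟩
      · refine Or.inr ⟨d :: w₁, w₂, rfl, ⟨?_, ?_⟩, h₂⟩
        · rw [contract_start, h1]
        · rwa [contract_finish]
    · exact Or.inr ⟨[], d :: w, rfl, hu.mk_eq, by rwa [← hu.mk_eq]⟩

/-- The left ideal of those `b` for which the product `b e_α` in `R^r(Γ)` already comes from
`R^r(Γ ∖ α)`. It contains, and is in fact equal to, the kernel of `R^r(Γ ∖ α) → R^r(Γ / α)`. -/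
def deletionConductor (r : ℕ) (Γ : OGraph V E) (α : E) : Ideal (R r (Γ.delete α)) where
  carrier := {b | deletionMap r Γ α b * R.gen r Γ α ∈ (deletionMap r Γ α).range}
  zero_mem' := ⟨0, by simp only [map_zero, zero_mul]⟩
  add_mem' ha hb := by
    rw [Set.mem_ofPred_eq, map_add, add_mul]
    exact add_mem ha hb
  smul_mem' c b hb := by
    rw [Set.mem_ofPred_eq, smul_eq_mul, map_mul, mul_assoc]
    exact mul_mem ⟨c, rfl⟩ hb

theorem mk_arnold_mem_deletionConductor_of_isWalk {p : List ({e : E // e ≠ α} × Bool)} {u v : V}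
    (hu : Γ.IsEnd α u) (hv : Γ.IsEnd α v) (hp : (Γ.delete α).IsWalk u p v) :
    R.mk r _ (arnold r p) ∈ deletionConductor r Γ α := by
  rcases hu.eq_or_exists_step hv with rfl | ⟨b, hs, hf⟩
  · rw [R.mk_arnold_of_isWalk hp]
    exact zero_mem _
  -- Since `p` followed by `α` is a circuit, its Arnold class `A(p) e_α ± e_p` vanishes.
  have hc : Γ.IsWalk u (p.map (Prod.map Subtype.val id) ++ [(α, b)]) u :=
    OGraph.isWalk_append.mpr
      ⟨v, hp.map (f := Subtype.val) (g := id) (fun _ => rfl) (fun _ => rfl), hs, hf⟩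
  have h := R.mk_arnold_of_isWalk (r := r) hc
  simp only [arnold_append, arnold_cons, edgeProd_cons, edgeProd_nil, arnold_nil, mul_one, mul_zero,
    smul_zero, add_zero, mul_smul_comm, ← map_arnold, ← map_edgeProd, map_add, map_mul,
    map_zsmul] at h
  change R.mk r Γ (Lambda.map Subtype.val (arnold r p)) * R.gen r Γ α ∈
    (deletionMap r Γ α).range
  rw [R.gen, eq_neg_of_add_eq_zero_left h]
  exact neg_mem (zsmul_mem (zsmul_mem (mk_mem_range_deletionMap _) _) _)

theorem mk_arnold_append_mem_deletionConductor {p w : List ({e : E // e ≠ α} × Bool)} {u v : V}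
    (hu : Γ.IsEnd α u) (hp : (Γ.delete α).IsWalk u p v)
    (hw : (Γ.contract α).IsWalk (Quot.mk _ v) w (Quot.mk _ (Γ.src α))) :
    R.mk r _ (arnold r (p ++ w)) ∈ deletionConductor r Γ α := by
  induction w generalizing p u v with
  | nil =>
    rw [List.append_nil]
    refine mk_arnold_mem_deletionConductor_of_isWalk hu ?_ hp
    rcases OGraph.eq_or_isEnd_of_mk_eq hw with h | h
    · exact Or.inl h
    · exact h.1
  | cons d w ih =>
    obtain ⟨h1, h2⟩ := hw
    rw [OGraph.contract_start] at h1
    rw [OGraph.contract_finish] at h2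
    rcases OGraph.eq_or_isEnd_of_mk_eq h1 with h | ⟨hs, hv⟩
    · rw [List.append_cons]
      exact ih hu (OGraph.isWalk_append.mpr ⟨v, hp, h, rfl⟩) h2
    · have ha := mk_arnold_mem_deletionConductor_of_isWalk (r := r) hu hv hp
      have hb := ih (p := [d]) hs ⟨rfl, rfl⟩ h2
      rw [arnold_append, arnold_mul_edgeProd, map_add, map_zsmul, map_zsmul, map_mul, map_mul]
      exact add_mem (zsmul_mem (Ideal.mul_mem_left _ _ ha) _)
        (zsmul_mem (Ideal.mul_mem_left _ _ hb) _)

theorem mk_arnold_mem_deletionConductor {w : List ({e : E // e ≠ α} × Bool)}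
    (hw : (Γ.contract α).IsCircuit w) : R.mk r _ (arnold r w) ∈ deletionConductor r Γ α := by
  obtain ⟨-, v, hw⟩ := hw
  obtain ⟨v, rfl⟩ := Quot.exists_rep v
  rcases OGraph.isWalk_delete_or_exists_append hw with h | ⟨w₁, w₂, rfl, h₁, h₂⟩
  · rw [R.mk_arnold_of_isWalk h]
    exact zero_mem _
  · rw [arnold_append_comm, map_zsmul]
    exact zsmul_mem (mk_arnold_append_mem_deletionConductor (p := []) (Or.inl rfl) rfl
      (OGraph.isWalk_append.mpr ⟨_, h₂, h₁⟩)) _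

theorem ker_deletionToContraction_le :
    RingHom.ker (deletionToContraction r Γ α) ≤ deletionConductor r Γ α := by
  intro b hb
  obtain ⟨z, rfl⟩ := R.mk_surjective r _ b
  rw [RingHom.mem_ker, deletionToContraction_mk] at hb
  have hle : arnoldIdeal r (Γ.contract α) ≤
      (deletionConductor r Γ α).comap (R.mk r (Γ.delete α)) :=
    Ideal.span_le.mpr (by
      rintro _ ⟨w, hw, rfl⟩
      exact mk_arnold_mem_deletionConductor hw)
  exact hle (Ideal.Quotient.eq_zero_iff_mem.mp hb)

theorem mem_range_deletionMap_of_residue_eq_zero (hα : Γ.src α ≠ Γ.tgt α) {x : R r Γ}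
    (hx : residue r Γ α hα x = 0) : x ∈ (deletionMap r Γ α).range := by
  obtain ⟨a, b, rfl⟩ := exists_deletionMap_add_mul_gen α x
  rw [map_add, residue_deletionMap, residue_deletionMap_mul_gen, zero_add] at hx
  exact add_mem ⟨a, rfl⟩ (ker_deletionToContraction_le hx)

end

/-! ### Deletion, contraction and inclusions of graphs -/

section

variable {V V' E E' : Type*} {r : ℕ} {Γ : OGraph V E} {α : E} {f : E' → E}

theorem R.map_injective_of_range_eq {Γ' : OGraph V' E'} {g : V' ≃ V}
    (hs : ∀ x, Γ.src (f x) = g (Γ'.src x)) (ht : ∀ x, Γ.tgt (f x) = g (Γ'.tgt x))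
    (hf : Function.Injective f) (hr : Set.range f = {α}ᶜ)
    (h : Function.Injective (deletionMap r Γ α)) : Function.Injective (R.map r f g hs ht) := by
  have hne (x : E') : f x ≠ α := by
    have hx : f x ∈ ({α}ᶜ : Set E) := hr ▸ Set.mem_range_self x
    exact hx
  have hbij : Function.Bijective fun x => (⟨f x, hne x⟩ : {e : E // e ≠ α}) := by
    refine ⟨fun x y hxy => hf (congrArg Subtype.val hxy), fun ⟨e, he⟩ => ?_⟩
    obtain ⟨x, rfl⟩ : e ∈ Set.range f := hr ▸ he
    exact ⟨x, rfl⟩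
  let i := Equiv.ofBijective _ hbij
  have hval (e : {e : E // e ≠ α}) : f (i.symm e) = e :=
    congrArg Subtype.val (i.apply_symm_apply e)
  let φ : R r Γ' →+* R r (Γ.delete α) := R.map r i g hs ht
  let φ' : R r (Γ.delete α) →+* R r Γ' := R.map r i.symm g.symm
    (fun e => by rw [Equiv.eq_symm_apply, ← hs, hval]; rfl)
    (fun e => by rw [Equiv.eq_symm_apply, ← ht, hval]; rfl)
  have hgen (x : E') : φ (R.gen r Γ' x) = R.gen r _ (i x) := R.map_gen ..
  have hgen' (e : {e : E // e ≠ α}) : φ' (R.gen r _ e) = R.gen r Γ' (i.symm e) := R.map_gen ..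
  have hφ : φ'.comp φ = RingHom.id _ := R.hom_ext fun x => by
    rw [RingHom.comp_apply, hgen, hgen', Equiv.symm_apply_apply, RingHom.id_apply]
  have hcomp : R.map r f g hs ht = (deletionMap r Γ α).comp φ := R.hom_ext fun x => by
    rw [RingHom.comp_apply, hgen, deletionMap_gen, R.map_gen, Equiv.ofBijective_apply]
  rw [hcomp]
  exact h.comp (Function.LeftInverse.injective (RingHom.congr_fun hφ))

/-- The graph with the same vertices as `Γ` and with an edge for each `x : E'`, which has the
ends of `f x`. For the inclusion `f` of a set of edges this is the subgraph of `Γ` with these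
edges, in particular `Γ.delete α` for the set of edges different from `α`. -/
def OGraph.comap (Γ : OGraph V E) (f : E' → E) : OGraph V E' where
  src x := Γ.src (f x)
  tgt x := Γ.tgt (f x)

/-- The map `R^r(Γ.comap f) → R^r(Γ)`, `e_x ↦ e_{f x}`. For the inclusion `f` of the set of edges
different from `α` this is the map `i_α`. -/
def R.ofComap (r : ℕ) (Γ : OGraph V E) (f : E' → E) : R r (Γ.comap f) →+* R r Γ :=
  R.map r f id (fun _ => rfl) (fun _ => rfl)

theorem R.ofComap_gen (x : E') : R.ofComap r Γ f (R.gen r _ x) = R.gen r Γ (f x) :=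
  R.map_gen ..

/-- The map induced by `R.ofComap` after the deletion of an edge. -/
def R.deleteComap (r : ℕ) (Γ : OGraph V E) (hf : Function.Injective f) (x : E') :
    R r ((Γ.comap f).delete x) →+* R r (Γ.delete (f x)) :=
  R.map r (Subtype.map f fun _ => hf.ne) id (fun _ => rfl) (fun _ => rfl)

theorem R.deleteComap_gen (hf : Function.Injective f) {x : E'} (y : {y : E' // y ≠ x}) :
    R.deleteComap r Γ hf x (R.gen r _ y) = R.gen r (Γ.delete (f x)) ⟨f y, hf.ne y.2⟩ :=
  R.map_gen ..

/-- The map induced by `R.ofComap` after the contraction of an edge. -/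
def R.contractComap (r : ℕ) (Γ : OGraph V E) (hf : Function.Injective f) (x : E') :
    R r ((Γ.comap f).contract x) →+* R r (Γ.contract (f x)) :=
  R.map r (Subtype.map f fun _ => hf.ne) id (fun _ => rfl) (fun _ => rfl)

theorem R.contractComap_gen (hf : Function.Injective f) {x : E'} (y : {y : E' // y ≠ x}) :
    R.contractComap r Γ hf x (R.gen r _ y) = R.gen r (Γ.contract (f x)) ⟨f y, hf.ne y.2⟩ :=
  R.map_gen ..

theorem range_subtypeMap_ne (hf : Function.Injective f) (hr : Set.range f = {α}ᶜ) (x : E')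
    (hα : α ≠ f x) :
    Set.range (Subtype.map f fun _ => hf.ne : {y // y ≠ x} → {e // e ≠ f x}) = {⟨α, hα⟩}ᶜ := by
  ext ⟨e, he⟩
  have hmem : e ∈ Set.range f ↔ e ≠ α := by rw [hr, Set.mem_compl_singleton_iff]
  simp only [Set.mem_compl_singleton_iff, ne_eq, Subtype.mk.injEq]
  rw [← ne_eq, ← hmem]
  constructor
  · rintro ⟨y, hy⟩
    exact ⟨y, congrArg Subtype.val hy⟩
  · rintro ⟨y, rfl⟩
    exact ⟨⟨y, fun hy => he (congrArg f hy)⟩, rfl⟩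

theorem R.deleteComap_injective (hf : Function.Injective f) (hr : Set.range f = {α}ᶜ) {x : E'}
    (hα : α ≠ f x) (h : Function.Injective (deletionMap r (Γ.delete (f x)) ⟨α, hα⟩)) :
    Function.Injective (R.deleteComap r Γ hf x) :=
  R.map_injective_of_range_eq (g := Equiv.refl V) _ _ (Subtype.map_injective _ hf)
    (range_subtypeMap_ne hf hr x hα) h

theorem R.contractComap_injective (hf : Function.Injective f) (hr : Set.range f = {α}ᶜ) {x : E'}
    (hα : α ≠ f x) (h : Function.Injective (deletionMap r (Γ.contract (f x)) ⟨α, hα⟩)) :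
    Function.Injective (R.contractComap r Γ hf x) :=
  R.map_injective_of_range_eq (g := Equiv.refl (Γ.ContractVertex (f x))) _ _
    (Subtype.map_injective _ hf) (range_subtypeMap_ne hf hr x hα) h

theorem R.ofComap_deletionMap (hf : Function.Injective f) (x : E')
    (a : R r ((Γ.comap f).delete x)) :
    R.ofComap r Γ f (deletionMap r (Γ.comap f) x a) =
      deletionMap r Γ (f x) (R.deleteComap r Γ hf x a) := by
  refine RingHom.congr_fun (f := (R.ofComap r Γ f).comp (deletionMap r _ x))
    (g := (deletionMap r Γ (f x)).comp (R.deleteComap r Γ hf x)) (R.hom_ext fun e => ?_) a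
  rw [RingHom.comp_apply, RingHom.comp_apply, deletionMap_gen, R.ofComap_gen, R.deleteComap_gen,
    deletionMap_gen]

theorem R.deletionToContraction_deleteComap (hf : Function.Injective f) (x : E')
    (a : R r ((Γ.comap f).delete x)) :
    deletionToContraction r Γ (f x) (R.deleteComap r Γ hf x a) =
      R.contractComap r Γ hf x (deletionToContraction r (Γ.comap f) x a) := by
  refine RingHom.congr_fun (f := (deletionToContraction r Γ (f x)).comp (R.deleteComap r Γ hf x))
    (g := (R.contractComap r Γ hf x).comp (deletionToContraction r _ x))
    (R.hom_ext fun e => ?_) a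
  rw [RingHom.comp_apply, RingHom.comp_apply, deletionToContraction_gen, R.deleteComap_gen,
    R.contractComap_gen, deletionToContraction_gen]

theorem residue_ofComap (hf : Function.Injective f) {x : E'}
    (hx : Γ.src (f x) ≠ Γ.tgt (f x)) (a : R r (Γ.comap f)) :
    residue r Γ (f x) hx (R.ofComap r Γ f a) =
      R.contractComap r Γ hf x (residue r (Γ.comap f) x hx a) := by
  obtain ⟨b, c, rfl⟩ := exists_deletionMap_add_mul_gen x a
  have hx' : (Γ.comap f).src x ≠ (Γ.comap f).tgt x := hx
  rw [map_add, map_mul, R.ofComap_deletionMap hf, R.ofComap_deletionMap hf, R.ofComap_gen,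
    map_add, map_add (residue r (Γ.comap f) x hx'), residue_deletionMap,
    residue_deletionMap_mul_gen, residue_deletionMap hx', residue_deletionMap_mul_gen hx',
    zero_add, zero_add, R.deletionToContraction_deleteComap]

end

/-! ### Loops and parallel edges -/

section

variable {V E E' : Type*} {r : ℕ} {Γ : OGraph V E} {Γ' : OGraph V E'}

theorem R.subsingleton_of_loop {e : E} (he : Γ.src e = Γ.tgt e) : Subsingleton (R r Γ) := by
  have hw : Γ.IsWalk (Γ.src e) [(e, true)] (Γ.src e) := ⟨rfl, he.symm⟩
  have h := R.mk_arnold_of_isWalk (r := r) hw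
  rw [arnold_cons, edgeProd_nil, arnold_nil, mul_zero, smul_zero, add_zero,
    show arnoldSign r 0 true = 1 by simp [arnoldSign], one_smul, map_one] at h
  exact subsingleton_of_zero_eq_one h.symm

/-- The augmentation of `R^r(Γ)` for a graph without loops, which sends all the generators to
zero. -/
def R.augmentation (r : ℕ) (Γ : OGraph V E) (hΓ : ∀ e, Γ.src e ≠ Γ.tgt e) : R r Γ →+* ℤ :=
  R.lift (Lambda.lift (fun _ => 0) (by simp) (by simp)) (by
    rintro w ⟨hne, v, hw⟩
    match w, hw with
    | [(e, true)], ⟨hs, ht⟩ => exact absurd (hs.trans ht.symm) (hΓ e)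
    | [(e, false)], ⟨ht, hs⟩ => exact absurd (hs.trans ht.symm) (hΓ e)
    | d :: d' :: w, _ => simp [arnold_cons])

theorem R.intCast_injective (hΓ : ∀ e, Γ.src e ≠ Γ.tgt e) :
    Function.Injective (Int.cast : ℤ → R r Γ) := by
  intro m n h
  simpa only [map_intCast, Int.cast_id] using congrArg (R.augmentation r Γ hΓ) h

/-- The sign by which the generator of an edge changes when its orientation is reversed
(`b = false`): it does not change if `r` is even, and is multiplied by `-1` if `r` is odd. -/
def directionSign (r : ℕ) (b : Bool) : ℤ := if b then 1 else -sgn r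

theorem directionSign_mul_self (r : ℕ) (b : Bool) :
    directionSign r b * directionSign r b = 1 := by
  cases b <;> simp [directionSign, sgn_mul_sgn]

theorem arnoldSign_eq_directionSign_mul (r : ℕ) (b c : Bool) :
    arnoldSign r 0 c = directionSign r b * arnoldSign r 0 (b == c) := by
  rcases Nat.even_or_odd r with hr | hr
  · cases b <;> simp [arnoldSign, directionSign, sgn, hr, hr.add_one.neg_one_pow]
  · cases b <;> cases c <;>
      simp [arnoldSign, directionSign, sgn, Nat.not_even_iff_odd.mpr hr, hr.add_one.neg_one_pow]

/-- The step that corresponds to `d` if each edge `e` is replaced by the step `F e`. Since `true`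
stands for the direction of the orientation, directions are composed by `==`. -/
def replaceStep (F : E → E' × Bool) (d : E × Bool) : E' × Bool := ((F d.1).1, (F d.1).2 == d.2)

/-- The map `Λ^r[E] → Λ^r[E']` which replaces each edge `e` by the step `F e`. -/
def Lambda.replace (r : ℕ) (F : E → E' × Bool) : Lambda r E →+* Lambda r E' :=
  Lambda.lift (fun e => directionSign r (F e).2 • Lambda.gen r (F e).1)
    (fun a b => by
      simp only [smul_mul_assoc, mul_smul_comm]
      rw [Lambda.gen_comm, smul_comm (sgn r), smul_comm (sgn r), smul_comm (directionSign r _)])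
    (fun a => by rw [smul_mul_assoc, mul_smul_comm, Lambda.gen_sq, smul_zero, smul_zero])

theorem Lambda.replace_gen (F : E → E' × Bool) (e : E) :
    Lambda.replace r F (Lambda.gen r e) = directionSign r (F e).2 • Lambda.gen r (F e).1 :=
  Lambda.lift_gen ..

theorem exists_replace_edgeProd_arnold (r : ℕ) (F : E → E' × Bool) (w : List (E × Bool)) :
    ∃ c : ℤ, Lambda.replace r F (edgeProd r w) = c • edgeProd r (w.map (replaceStep F)) ∧
      Lambda.replace r F (arnold r w) = c • arnold r (w.map (replaceStep F)) := by
  induction w with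
  | nil => exact ⟨1, by simp, by simp⟩
  | cons d w ih =>
    obtain ⟨c, h1, h2⟩ := ih
    refine ⟨directionSign r (F d.1).2 * c, ?_, ?_⟩
    · rw [edgeProd_cons, map_mul, h1, Lambda.replace_gen, List.map_cons, edgeProd_cons]
      simp only [replaceStep, smul_mul_assoc, mul_smul_comm, smul_smul, mul_comm]
    · rw [arnold_cons, map_add, map_zsmul, map_zsmul, map_mul, h1, h2, Lambda.replace_gen,
        List.map_cons, arnold_cons, arnoldSign_eq_directionSign_mul r (F d.1).2 d.2]
      simp only [replaceStep, smul_mul_assoc, mul_smul_comm, smul_smul, smul_add]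
      congr 2 <;> ring

theorem OGraph.IsWalk.replace {F : E → E' × Bool} (hs : ∀ e, Γ'.start (F e) = Γ.src e)
    (ht : ∀ e, Γ'.finish (F e) = Γ.tgt e) {w : List (E × Bool)} {u v : V} (hw : Γ.IsWalk u w v) :
    Γ'.IsWalk u (w.map (replaceStep F)) v := by
  have hstart (d : E × Bool) : Γ'.start (replaceStep F d) = Γ.start d := by
    obtain ⟨e, c⟩ := d
    specialize hs e; specialize ht e
    cases c <;> cases h : (F e).2 <;> simp_all [replaceStep, start, finish]
  have hfinish (d : E × Bool) : Γ'.finish (replaceStep F d) = Γ.finish d := by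
    obtain ⟨e, c⟩ := d
    specialize hs e; specialize ht e
    cases c <;> cases h : (F e).2 <;> simp_all [replaceStep, start, finish]
  induction w generalizing u with
  | nil => exact hw
  | cons d w ih => exact ⟨(hstart d).trans hw.1, (hfinish d).symm ▸ ih hw.2⟩

/-- The map `R^r(Γ) → R^r(Γ')` which replaces each edge `e` by the step `F e` with the same
ends. -/
def R.replace (r : ℕ) (F : E → E' × Bool) (hs : ∀ e, Γ'.start (F e) = Γ.src e)
    (ht : ∀ e, Γ'.finish (F e) = Γ.tgt e) : R r Γ →+* R r Γ' :=
  R.lift ((R.mk r Γ').comp (Lambda.replace r F)) (by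
    rintro w ⟨-, v, hw⟩
    obtain ⟨c, -, hc⟩ := exists_replace_edgeProd_arnold r F w
    rw [RingHom.comp_apply, hc, map_zsmul, R.mk_arnold_of_isWalk (hw.replace hs ht), smul_zero])

theorem R.replace_gen (F : E → E' × Bool) (hs : ∀ e, Γ'.start (F e) = Γ.src e)
    (ht : ∀ e, Γ'.finish (F e) = Γ.tgt e) (e : E) :
    R.replace r F hs ht (R.gen r Γ e) = directionSign r (F e).2 • R.gen r Γ' (F e).1 := by
  rw [R.replace, R.lift_gen, RingHom.comp_apply, Lambda.replace_gen, map_zsmul, R.gen]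

/-- The edge `e` is parallel to the edge of the step `d`, where the direction of `d` is the one that
agrees with the orientation of `e`. -/
def OGraph.IsParallel (Γ : OGraph V E) (e : E) (d : E × Bool) : Prop :=
  Γ.start d = Γ.src e ∧ Γ.finish d = Γ.tgt e

theorem OGraph.IsParallel.symm {e d : E} {b : Bool} (h : Γ.IsParallel e (d, b)) :
    Γ.IsParallel d (e, b) := by
  cases b
  · exact ⟨h.2.symm, h.1.symm⟩
  · exact ⟨h.1.symm, h.2.symm⟩

theorem R.gen_eq_of_isParallel {e : E} {d : E × Bool} (h : Γ.IsParallel e d) :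
    R.gen r Γ e = directionSign r d.2 • R.gen r Γ d.1 := by
  obtain ⟨d, b⟩ := d
  have hw : Γ.IsWalk (Γ.src e) [(e, true), (d, !b)] (Γ.src e) := by
    cases b
    · exact ⟨rfl, h.2, h.1⟩
    · exact ⟨rfl, h.2, h.1⟩
  have h := R.mk_arnold_of_isWalk (r := r) hw
  have hsign : arnoldSign r 0 (!b) * sgn r = -directionSign r b := by
    rcases Nat.even_or_odd r with hr | hr
    · cases b <;> simp [arnoldSign, directionSign, sgn, hr, hr.add_one.neg_one_pow]
    · cases b <;>
        simp [arnoldSign, directionSign, sgn, Nat.not_even_iff_odd.mpr hr, hr.add_one.neg_one_pow]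
  simp only [arnold_cons, arnold_nil, edgeProd_cons, edgeProd_nil, mul_one, mul_zero, smul_zero,
    add_zero, mul_smul_comm, smul_smul, mul_comm (sgn r), hsign,
    show arnoldSign r 0 true = 1 by simp [arnoldSign], one_smul, neg_smul, map_add, map_neg,
    map_zsmul] at h
  have hd : R.gen r Γ d = directionSign r b • R.gen r Γ e := add_neg_eq_zero.mp h
  rw [hd, smul_smul, directionSign_mul_self, one_smul]

open Classical in
theorem deletionMap_bijective_of_isParallel {α : E} {d : E × Bool} (hd : d.1 ≠ α)
    (h : Γ.IsParallel α d) : Function.Bijective (deletionMap r Γ α) := by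
  let F (e : E) : {e : E // e ≠ α} × Bool :=
    if he : e = α then (⟨d.1, hd⟩, d.2) else (⟨e, he⟩, true)
  have hFα : F α = (⟨d.1, hd⟩, d.2) := dif_pos rfl
  have hF (e : {e : E // e ≠ α}) : F e = (e, true) := dif_neg e.2
  have hs (e : E) : (Γ.delete α).start (F e) = Γ.src e := by
    rcases eq_or_ne e α with rfl | he
    · rw [hFα]; exact h.1
    · rw [hF ⟨e, he⟩]; rfl
  have ht (e : E) : (Γ.delete α).finish (F e) = Γ.tgt e := by
    rcases eq_or_ne e α with rfl | he
    · rw [hFα]; exact h.2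
    · rw [hF ⟨e, he⟩]; rfl
  have hgen (e : {e : E // e ≠ α}) : R.replace r F hs ht (R.gen r Γ e) = R.gen r _ e := by
    rw [R.replace_gen, hF]
    exact one_smul ℤ _
  have hleft : (R.replace r F hs ht).comp (deletionMap r Γ α) = RingHom.id _ :=
    R.hom_ext fun e => by
      rw [RingHom.comp_apply, deletionMap_gen, hgen, RingHom.id_apply]
  have hright : (deletionMap r Γ α).comp (R.replace r F hs ht) = RingHom.id _ :=
    R.hom_ext fun e => by
      rcases eq_or_ne e α with rfl | he
      · rw [RingHom.comp_apply, R.replace_gen, hFα, map_zsmul, deletionMap_gen,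
          ← R.gen_eq_of_isParallel h, RingHom.id_apply]
      · rw [RingHom.comp_apply, hgen ⟨e, he⟩, deletionMap_gen, RingHom.id_apply]
  exact Function.bijective_iff_has_inverse.mpr
    ⟨_, RingHom.congr_fun hleft, RingHom.congr_fun hright⟩

theorem OGraph.contract_src_ne_tgt {α β : E} (hα : Γ.src α ≠ Γ.tgt α) (hne : α ≠ β)
    (h : ∀ b, ¬ Γ.IsParallel α (β, b)) :
    (Γ.contract β).src ⟨α, hne⟩ ≠ (Γ.contract β).tgt ⟨α, hne⟩ := by
  intro he
  rcases eq_or_isEnd_of_mk_eq he with he | ⟨h1, h2⟩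
  · exact hα he
  rcases h1.eq_or_exists_step h2 with he | ⟨b, hs, ht⟩
  · exact hα he
  · refine h (!b) ?_
    cases b <;> exact ⟨ht, hs⟩

end

/-! ### Injectivity for finite graphs -/

section

universe u v

variable {V : Type u} {E : Type v} {r : ℕ} {Γ : OGraph V E} {α : E}

/-- Simple graphs: no edge is a loop, and no two edges are parallel. The contraction of an
edge of such a graph creates no loops. -/
structure OGraph.IsSimple (Γ : OGraph V E) : Prop where
  src_ne_tgt (e : E) : Γ.src e ≠ Γ.tgt e
  eq_of_isParallel {e : E} {d : E × Bool} (h : Γ.IsParallel e d) : d.1 = e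

theorem OGraph.IsSimple.delete (hΓ : Γ.IsSimple) (α : E) : (Γ.delete α).IsSimple where
  src_ne_tgt e := hΓ.src_ne_tgt e
  eq_of_isParallel {_ d} h := Subtype.ext (hΓ.eq_of_isParallel (d := (d.1, d.2)) h)

theorem OGraph.IsSimple.contract_src_ne_tgt (hΓ : Γ.IsSimple) {α β : E} (hne : α ≠ β) :
    (Γ.contract β).src ⟨α, hne⟩ ≠ (Γ.contract β).tgt ⟨α, hne⟩ :=
  OGraph.contract_src_ne_tgt (hΓ.src_ne_tgt α) hne fun _ h => hne (hΓ.eq_of_isParallel h).symm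

/-- The injectivity of `i_α` for the graphs with less than `n` edges, which is the hypothesis of
an induction on the number of edges. -/
def DeletionMapInjectiveBelow (r n : ℕ) : Prop :=
  ∀ ⦃V : Type u⦄ ⦃E : Type v⦄ [Finite E] (Γ : OGraph V E) (α : E), Γ.src α ≠ Γ.tgt α →
    Nat.card E < n → Function.Injective (deletionMap r Γ α)

theorem DeletionMapInjectiveBelow.mono {m n : ℕ} (h : DeletionMapInjectiveBelow.{u, v} r n)
    (hmn : m ≤ n) : DeletionMapInjectiveBelow.{u, v} r m :=
  fun _ _ _ Γ α hα hm => h Γ α hα (hm.trans_le hmn)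

theorem card_edges_ne_lt [Finite E] (α : E) : Nat.card {e : E // e ≠ α} < Nat.card E :=
  Finite.card_subtype_lt (not_not.mpr rfl)

theorem residue_delete_eq_zero [Finite E] (hΓ : Γ.IsSimple)
    (ih : DeletionMapInjectiveBelow.{u, v} r (Nat.card E)) {γ : E} {y : R r (Γ.delete γ)}
    (δ : {e : E // e ≠ γ})
    (hy : residue r Γ δ (hΓ.src_ne_tgt δ) (deletionMap r Γ γ y) = 0) :
    residue r (Γ.delete γ) δ ((hΓ.delete γ).src_ne_tgt δ) y = 0 := by
  have hne : γ ≠ δ := δ.2.symm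
  have hinj := R.contractComap_injective (x := δ) Subtype.val_injective Subtype.range_val hne
    (ih (Γ.contract δ) _ (hΓ.contract_src_ne_tgt hne) (card_edges_ne_lt _))
  refine (map_eq_zero_iff _ hinj).mp ?_
  exact (residue_ofComap Subtype.val_injective (hΓ.src_ne_tgt δ) y).symm.trans hy

theorem R.intCast_surjective_of_isEmpty [IsEmpty E] :
    Function.Surjective (Int.cast : ℤ → R r Γ) := by
  intro x
  induction x using R.induction with
  | hint m => exact ⟨m, rfl⟩
  | hgen e => exact isEmptyElim e
  | hadd a b ha hb =>
    obtain ⟨m, rfl⟩ := ha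
    obtain ⟨n, rfl⟩ := hb
    exact ⟨m + n, Int.cast_add m n⟩
  | hmul a b ha hb =>
    obtain ⟨m, rfl⟩ := ha
    obtain ⟨n, rfl⟩ := hb
    exact ⟨m * n, Int.cast_mul m n⟩

theorem exists_intCast_eq_of_residue_eq_zero [Finite E] (hΓ : Γ.IsSimple)
    (ih : DeletionMapInjectiveBelow.{u, v} r (Nat.card E)) {x : R r Γ}
    (hx : ∀ e, residue r Γ e (hΓ.src_ne_tgt e) x = 0) : ∃ m : ℤ, (m : R r Γ) = x := by
  induction hn : Nat.card E using Nat.strong_induction_on generalizing E with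
  | h n IH =>
    rcases isEmpty_or_nonempty E with hE | ⟨⟨γ⟩⟩
    · exact R.intCast_surjective_of_isEmpty x
    · obtain ⟨y, rfl⟩ := mem_range_deletionMap_of_residue_eq_zero _ (hx γ)
      obtain ⟨m, rfl⟩ := IH _ (hn ▸ card_edges_ne_lt γ) (hΓ.delete γ)
        (ih.mono (card_edges_ne_lt γ).le) (fun δ => residue_delete_eq_zero hΓ ih δ (hx δ)) rfl
      exact ⟨m, (map_intCast _ m).symm⟩

theorem deletionMap_injective_of_isSimple [Finite E] (hΓ : Γ.IsSimple)
    (ih : DeletionMapInjectiveBelow.{u, v} r (Nat.card E)) (α : E) :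
    Function.Injective (deletionMap r Γ α) := by
  refine (injective_iff_map_eq_zero _).mpr fun a ha => ?_
  obtain ⟨m, rfl⟩ := exists_intCast_eq_of_residue_eq_zero (hΓ.delete α)
    (ih.mono (card_edges_ne_lt α).le)
    (fun δ => residue_delete_eq_zero hΓ ih δ (by rw [ha, map_zero]))
  rw [map_intCast, ← Int.cast_zero] at ha
  rw [R.intCast_injective hΓ.src_ne_tgt ha, Int.cast_zero]

theorem deletionMap_injective_of_delete_isParallel {e : E} {d : E × Bool} (he : e ≠ α)
    (hd : d.1 ≠ α) (hde : d.1 ≠ e) (h : Γ.IsParallel e d)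
    (hinj : Function.Injective (deletionMap r (Γ.delete e) ⟨α, he.symm⟩)) :
    Function.Injective (deletionMap r Γ α) := by
  refine (injective_iff_map_eq_zero _).mpr fun a ha => ?_
  have hsurj : Function.Surjective (deletionMap r (Γ.delete α) ⟨e, he⟩) :=
    (deletionMap_bijective_of_isParallel (α := ⟨e, he⟩) (d := (⟨d.1, hd⟩, d.2))
      (fun h' => hde (congrArg Subtype.val h')) h).surjective
  obtain ⟨b, rfl⟩ := hsurj a
  have hb : deletionMap r Γ e (R.deleteComap r Γ Subtype.val_injective ⟨e, he⟩ b) = 0 :=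
    (R.ofComap_deletionMap Subtype.val_injective (⟨e, he⟩ : {e // e ≠ α}) b).symm.trans ha
  have hinj' := R.deleteComap_injective (x := ⟨e, he⟩) Subtype.val_injective
    Subtype.range_val he.symm hinj
  have hb' := (map_eq_zero_iff _ (deletionMap_bijective_of_isParallel hde h).injective).mp hb
  have hb0 : b = 0 := (map_eq_zero_iff _ hinj').mp hb'
  rw [hb0, map_zero]

theorem deletionMap_injective_of_not_isSimple (hα : Γ.src α ≠ Γ.tgt α) (hΓ : ¬ Γ.IsSimple)
    (hinj : ∀ e (he : e ≠ α), Function.Injective (deletionMap r (Γ.delete e) ⟨α, he.symm⟩)) :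
    Function.Injective (deletionMap r Γ α) := by
  by_cases hloop : ∃ e, Γ.src e = Γ.tgt e
  · obtain ⟨e, he⟩ := hloop
    have hne : e ≠ α := fun h => hα (h ▸ he)
    have := R.subsingleton_of_loop (r := r) (Γ := Γ.delete α) (e := ⟨e, hne⟩) he
    exact Function.injective_of_subsingleton _
  obtain ⟨e, d, h, hde⟩ : ∃ e d, Γ.IsParallel e d ∧ d.1 ≠ e := by
    by_contra! hpar
    exact hΓ ⟨fun e he => hloop ⟨e, he⟩, fun h => hpar _ _ h⟩
  rcases eq_or_ne e α with rfl | he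
  · exact (deletionMap_bijective_of_isParallel hde h).injective
  rcases eq_or_ne d.1 α with rfl | hd
  · exact (deletionMap_bijective_of_isParallel he h.symm).injective
  · exact deletionMap_injective_of_delete_isParallel he hd hde h (hinj e he)

theorem deletionMapInjectiveBelow (r n : ℕ) : DeletionMapInjectiveBelow.{u, v} r n := by
  induction n with
  | zero => exact fun _ _ _ _ _ _ h => absurd h (Nat.not_lt_zero _)
  | succ n ih =>
    intro V E _ Γ α hα hn
    have ih' := ih.mono (Nat.lt_succ_iff.mp hn)
    by_cases hΓ : Γ.IsSimple
    · exact deletionMap_injective_of_isSimple hΓ ih' α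
    · exact deletionMap_injective_of_not_isSimple hα hΓ fun e he =>
        ih' (Γ.delete e) _ hα (card_edges_ne_lt e)

theorem deletionMap_injective_of_finite [Finite E] (hα : Γ.src α ≠ Γ.tgt α) :
    Function.Injective (deletionMap r Γ α) :=
  deletionMapInjectiveBelow r _ Γ α hα (Nat.lt_succ_self _)

end

/-! ### Reduction to finite graphs -/

section

open Filter

variable {V X Y E : Type*} {r : ℕ} {Γ : OGraph V E} {α : E}

theorem Lambda.map_map {Z : Type*} (f : X → Y) (g : Y → Z) (y : Lambda r X) :
    Lambda.map g (Lambda.map f y) = Lambda.map (g ∘ f) y := by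
  refine RingHom.congr_fun (f := (Lambda.map g).comp (Lambda.map f)) (Lambda.hom_ext fun x => ?_) y
  rw [RingHom.comp_apply, Lambda.map_gen, Lambda.map_gen, Lambda.map_gen, Function.comp_apply]

theorem Lambda.map_leftInverse {f : X → Y} {g : Y → X} (h : Function.LeftInverse g f) :
    Function.LeftInverse (Lambda.map (r := r) g) (Lambda.map f) :=
  RingHom.congr_fun (f := (Lambda.map g).comp (Lambda.map f)) (g := RingHom.id _)
    (Lambda.hom_ext fun x => by
      rw [RingHom.comp_apply, Lambda.map_gen, Lambda.map_gen, h, RingHom.id_apply])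

theorem eventually_mem_range_lambdaMap (f : X → E) (y : Lambda r X) :
    ∀ᶠ T : Finset E in atTop,
      y ∈ (Lambda.map (r := r) (Subtype.val : {x // f x ∈ T} → X)).range := by
  induction y using Lambda.induction with
  | hint n => exact Eventually.of_forall fun T => intCast_mem _ n
  | hgen x =>
    filter_upwards [eventually_ge_atTop {f x}] with T hT
    exact ⟨Lambda.gen r ⟨x, hT (Finset.mem_singleton_self _)⟩, Lambda.map_gen ..⟩
  | hadd a b ha hb => filter_upwards [ha, hb] with T ha hb using add_mem ha hb
  | hmul a b ha hb => filter_upwards [ha, hb] with T ha hb using mul_mem ha hb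

theorem OGraph.isWalk_comap {f : X → E} {w : List (X × Bool)} {u v : V} :
    (Γ.comap f).IsWalk u w v ↔ Γ.IsWalk u (w.map (Prod.map f id)) v := by
  induction w generalizing u with
  | nil => rfl
  | cons d w ih => exact and_congr_right' ih

theorem eventually_exists_map_eq_of_mem_arnoldIdeal {z : Lambda r E} (hz : z ∈ arnoldIdeal r Γ) :
    ∀ᶠ T : Finset E in atTop,
      ∃ y ∈ arnoldIdeal r (Γ.comap (Subtype.val : T → E)), Lambda.map Subtype.val y = z := by
  induction hz using Submodule.span_induction with
  | mem z hz =>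
    obtain ⟨w, ⟨hne, v, hw⟩, rfl⟩ := hz
    classical
    filter_upwards [eventually_ge_atTop (w.map Prod.fst).toFinset] with T hT
    obtain ⟨w', rfl⟩ : w ∈ Set.range (List.map (Prod.map (Subtype.val : T → E) id)) := by
      rw [Set.range_list_map]
      exact fun d hd => ⟨(⟨d.1, hT (List.mem_toFinset.mpr (List.mem_map_of_mem hd))⟩, d.2), rfl⟩
    refine ⟨arnold r w', Ideal.subset_span ⟨w', ⟨?_, v, OGraph.isWalk_comap.mpr hw⟩, rfl⟩,
      map_arnold ..⟩
    rintro rfl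
    exact hne rfl
  | zero => exact Eventually.of_forall fun T => ⟨0, zero_mem _, map_zero _⟩
  | add a b _ _ ha hb =>
    filter_upwards [ha, hb] with T ⟨a', ha', ha⟩ ⟨b', hb', hb⟩
    exact ⟨a' + b', add_mem ha' hb', by rw [map_add, ha, hb]⟩
  | smul a b _ hb =>
    filter_upwards [eventually_mem_range_lambdaMap (fun e => e) a, hb] with T ⟨a', ha⟩ ⟨b', hb', hb⟩
    exact ⟨a' * b', Ideal.mul_mem_left _ a' hb', (map_mul _ _ _).trans (congrArg₂ _ ha hb)⟩

theorem mk_comap_delete_eq_zero (hα : Γ.src α ≠ Γ.tgt α) {T : Finset E} (hαT : α ∈ T)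
    {y : Lambda r {x : {e // e ≠ α} // x.1 ∈ T}} {y' : Lambda r T}
    (hy' : y' ∈ arnoldIdeal r (Γ.comap (Subtype.val : T → E)))
    (h : Lambda.map Subtype.val y' = Lambda.map Subtype.val (Lambda.map Subtype.val y)) :
    R.mk r ((Γ.delete α).comap Subtype.val) y = 0 := by
  let αT : T := ⟨α, hαT⟩
  let f (x : {x : {e // e ≠ α} // x.1 ∈ T}) : T := ⟨x.1, x.2⟩
  have hf : Function.Injective f := fun x x' hx =>
    Subtype.ext (Subtype.ext (congrArg (fun e : T => (e : E)) hx))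
  have hr : Set.range f = {αT}ᶜ := by
    ext e
    refine ⟨?_, fun he => ⟨⟨⟨e, fun h => he (Subtype.ext h)⟩, e.2⟩, rfl⟩⟩
    rintro ⟨x, rfl⟩ h
    exact x.1.2 (congrArg Subtype.val h)
  have hinj : Function.Injective (Lambda.map (r := r) (Subtype.val : T → E)) := by
    have : Nonempty T := ⟨αT⟩
    exact (Lambda.map_leftInverse (Function.leftInverse_invFun Subtype.val_injective)).injective
  have hy : Lambda.map f y = y' := by
    refine hinj (h.trans ?_).symm
    rw [Lambda.map_map, Lambda.map_map]
    rfl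
  have hinj' := R.map_injective_of_range_eq (Γ := Γ.comap (Subtype.val : T → E))
    (Γ' := (Γ.delete α).comap (Subtype.val : {x : {e // e ≠ α} // x.1 ∈ T} → _))
    (g := Equiv.refl V) (fun _ => rfl) (fun _ => rfl) hf hr
    (deletionMap_injective_of_finite (r := r) hα)
  exact (map_eq_zero_iff _ hinj').mp (Ideal.Quotient.eq_zero_iff_mem.mpr (hy.symm ▸ hy'))

theorem deletionMap_injective (hα : Γ.src α ≠ Γ.tgt α) :
    Function.Injective (deletionMap r Γ α) := by
  refine (injective_iff_map_eq_zero _).mpr fun a ha => ?_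
  obtain ⟨z, rfl⟩ := R.mk_surjective r _ a
  have hz : Lambda.map Subtype.val z ∈ arnoldIdeal r Γ := Ideal.Quotient.eq_zero_iff_mem.mp ha
  obtain ⟨T, ⟨y, hy⟩, ⟨y', hy', hyz⟩, hαT⟩ :=
    ((eventually_mem_range_lambdaMap Subtype.val z).and
      ((eventually_exists_map_eq_of_mem_arnoldIdeal hz).and (eventually_ge_atTop {α}))).exists
  have hy0 : R.mk r ((Γ.delete α).comap Subtype.val) y = 0 :=
    mk_comap_delete_eq_zero hα (Finset.singleton_subset_iff.mp hαT) hy' (by rw [hyz, ← hy])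
  rw [← hy]
  exact (congrArg (R.ofComap r (Γ.delete α) Subtype.val) hy0).trans (map_zero _)

end

theorem exists_deletionMap_eq_of_psi_eq_tensorInl {V E : Type*} {r : ℕ} {Γ : OGraph V E} {α : E}
    (hα : Γ.src α ≠ Γ.tgt α) {x : R r Γ} {y : R r (Γ.contract α)}
    (h : psi r Γ α hα x = tensorInl r _ y) :
    ∃ a, deletionToContraction r Γ α a = y ∧ deletionMap r Γ α a = x := by
  obtain ⟨a, rfl⟩ := mem_range_deletionMap_of_residue_eq_zero hα
    (residue_eq_zero_of_psi_eq_tensorInl hα h)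
  exact ⟨a, tensorInl_injective r _ ((psi_deletionMap hα a).symm.trans h), rfl⟩

theorem isPullback_ringCat_of_injective.{u} {A B C D : RingCat.{u}} {f : A ⟶ B} {g : A ⟶ C}
    {h : B ⟶ D} {k : C ⟶ D} (hcomm : f ≫ h = g ≫ k) (hg : Function.Injective g)
    (hexists : ∀ b c, h b = k c → ∃ a, f a = b ∧ g a = c) : IsPullback f g h k := by
  refine IsPullback.of_map (forget RingCat) hcomm ?_
  rw [Limits.Types.isPullback_iff]
  refine ⟨?_, fun a b hab => hg hab.2, hexists⟩
  rw [← Functor.map_comp, ← Functor.map_comp, hcomm]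

end GraphRing

end

theorem theorem1 {V : Type*} {E : Type*} (r : ℕ) (Γ : GraphRing.OGraph V E) (α : E)
    (hα : Γ.src α ≠ Γ.tgt α) :
    IsPullback
      (RingCat.ofHom (GraphRing.deletionToContraction r Γ α))
      (RingCat.ofHom (GraphRing.deletionMap r Γ α))
      (RingCat.ofHom (GraphRing.tensorInl r (Γ.contract α)))
      (RingCat.ofHom (GraphRing.psi r Γ α hα)) ∧
    Function.Injective (GraphRing.deletionMap r Γ α) ∧
    Function.Surjective (GraphRing.psi r Γ α hα) := by
  have hinj := GraphRing.deletionMap_injective (r := r) hα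
  refine ⟨GraphRing.isPullback_ringCat_of_injective ?_ hinj ?_, hinj, GraphRing.psi_surjective hα⟩
  · ext a
    exact (GraphRing.psi_deletionMap hα a).symm
  · exact fun y x h => GraphRing.exists_deletionMap_eq_of_psi_eq_tensorInl hα h.symm
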